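/- Let $\Bbbk$ be an algebraically closed field of characteristic zero and let $G=\mathbb{Z}_{m_1}\times\cdots\times\mathbb{Z}_{m_n}$ with $m_i\ge 1$ and $m_i\mid m_{i+1}$ for $1\le i\le n-1$. For each $i$ fix a generator $g_i$ of $\mathbb{Z}_{m_i}$, and for each occurring $m=m_r$ fix a primitive $m$-th root of unity $\zeta_m\in\Bbbk^*$. For $\alpha=(\alpha_1,\dots,\alpha_n)$ with $0\le\alpha_r<m_r$ put $g^{\alpha}=g_1^{\alpha_1}\cdots g_n^{\alpha_n}$. Let $(B_\bullet,\partial_\bullet)$ be the normalized bar resolution of $G$, so that $B_k$ is the free $\mathbb{Z}G$-module on the symbols $[h_1,\dots,h_k]$ with all $h_i\in G\setminus\{1\}$ (and $[h_1,\dots,h_k]=0$ if some $h_i=1$). Let $(B^*_\bullet,\partial^*_\bullet)$ be the complex $\operatorname{Hom}_{\mathbb{Z}G}(B_\bullet,\Bbbk^*)$, where $G$ acts trivially on $\Bbbk^*$. Fix $k\ge 1$. For a sequence $\alpha_1,\dots,\alpha_k$ of exponent vectors, $\alpha_i=(\alpha_{i1},\dots,\alpha_{in})$ with $0\le\alpha_{ir}<m_r$,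 and for $1\le r\le n$, $1\le a\le b\le k$, let $$\eta^{\alpha}_{r,[a,b]}=\begin{cases}\left[\frac{\alpha_{br}+\alpha_{b-1,r}}{m_r}\right]\left[\frac{\alpha_{b-2,r}+\alpha_{b-3,r}}{m_r}\right]\cdots\left[\frac{\alpha_{a+1,r}+\alpha_{ar}}{m_r}\right], & b-a \text{ odd},\\[4pt] \left[\frac{\alpha_{br}+\alpha_{b-1,r}}{m_r}\right]\cdots\left[\frac{\alpha_{a+2,r}+\alpha_{a+1,r}}{m_r}\right]\alpha_{ar}, & b-a\text{ even},\end{cases}$$ where $[x]$ denotes the integer part of $x$. Consider all families of integers $a=(a_{r_1^{\lambda_1}\cdots r_l^{\lambda_l}})$ with $0\le a_{r_1^{\lambda_1}\cdots r_l^{\lambda_l}}<m_{r_1}$, one integer for each choice of $1\le l\le k$, $1\le r_1<\cdots<r_l\le n$ and integers $\lambda_1,\dots,\lambda_l\ge 1$ with $\lambda_1+\cdots+\lambda_l=k$ and $\lambda_1$ odd. Then for every such family $a$ there is a well-defined cochain $\omega_a\in\operatorname{Hom}_{\mathbb{Z}G}(B_k,\Bbbk^*)$ such that $$\omega_a([g^{\alpha_1},\dots,g^{\alpha_k}])=\prod_{l=1}^{k}\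 \prod_{\substack{1\le r_1<\cdots<r_l\le n\\ \lambda_1+\cdots+\lambda_l=k,\ \lambda_1\text{ odd}\\ \lambda_i\ge 1}}\zeta_{m_{r_1}}^{(-1)^{\sum_{1\le i<j\le l}\lambda_i\lambda_j}\,\eta^{\alpha}_{r_1,[a_1,b_1]}\cdots\eta^{\alpha}_{r_l,[a_l,b_l]}\,a_{r_1^{\lambda_1}\cdots r_l^{\lambda_l}}}$$ for all $\alpha_1,\dots,\alpha_k$, where $a_u=\sum_{i=u+1}^{l}\lambda_i+1$ and $b_u=\sum_{i=u}^{l}\lambda_i$. The cochains $\omega_a$ form a complete set of representatives of the $k$-cocycles of $(B^*_\bullet,\partial^*_\bullet)$: each $\omega_a$ is a $k$-cocycle, and every $k$-cocycle is cohomologous in $(B^*_\bullet,\partial^*_\bullet)$ to $\omega_a$ for exactly one family $a$. -/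

import Mathlib

noncomputable section

namespace BarCocycle

/-! ### The normalized bar resolution and its dual complex -/

section Bar

variable (G : Type) [Group G]

/-- The module `B_k` of the normalized bar resolution: the free left `ℤ[G]`-module on the symbols
`[h_1, …, h_k]` with all `h_i ≠ 1`. -/
abbrev Bar (k : ℕ) : Type := (Fin k → {x : G // x ≠ 1}) →₀ MonoidAlgebra ℤ G

open Classical in
/-- The symbol `[h_1, …, h_k]` for arbitrary `h_i ∈ G`; it is `0` as soon as some `h_i = 1`. -/
def barSymbol {k : ℕ} (h : Fin k → G) : Bar G k :=
  if H : ∀ i, h i ≠ 1 then Finsupp.single (fun i => ⟨h i, H i⟩) 1 else 0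

/-- The differential `∂ : B_{k+1} → B_k`,
`∂[h_1, …, h_{k+1}] = h_1 [h_2, …, h_{k+1}]
  + ∑_{j=1}^{k} (-1)^j [h_1, …, h_j h_{j+1}, …, h_{k+1}] + (-1)^{k+1} [h_1, …, h_k]`.
(For the last index, `Fin.contractNth` drops the last entry.) -/
def barBoundary (k : ℕ) : Bar G (k + 1) →ₗ[MonoidAlgebra ℤ G] Bar G k :=
  Finsupp.linearCombination (MonoidAlgebra ℤ G) fun h : Fin (k + 1) → {x : G // x ≠ 1} =>
    MonoidAlgebra.of ℤ G (h 0 : G) • barSymbol G (fun i : Fin k => (h i.succ : G)) +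
      ∑ j : Fin (k + 1), (-1 : ℤ) ^ ((j : ℕ) + 1) •
        barSymbol G (Fin.contractNth j (fun x y : G => x * y) (fun i => (h i : G)))

variable (𝕜 : Type*) [Field 𝕜]

/-- The multiplicative group `𝕜ˣ`, written additively, as a trivial `ℤ[G]`-module. -/
abbrev UnitsModule : Type _ := (Representation.trivial ℤ G (Additive 𝕜ˣ)).asModule

/-- `k`-cochains of the dual complex: `Hom_{ℤ[G]}(B_k, 𝕜ˣ)`, an additively written group. -/
abbrev Cochain (k : ℕ) : Type _ := Bar G k →ₗ[MonoidAlgebra ℤ G] UnitsModule G 𝕜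

variable {G 𝕜}

/-- The value `f([h_1, …, h_k]) ∈ 𝕜ˣ`, written multiplicatively. -/
def Cochain.value {k : ℕ} (f : Cochain G 𝕜 k) (h : Fin k → G) : 𝕜ˣ :=
  Additive.toMul
    ((Representation.trivial ℤ G (Additive 𝕜ˣ)).asModuleEquiv (f (barSymbol G h)))

variable (G 𝕜)

/-- The differential `∂* : Hom(B_k, 𝕜ˣ) → Hom(B_{k+1}, 𝕜ˣ)`, `f ↦ f ∘ ∂`. -/
def dualBoundary (k : ℕ) : Cochain G 𝕜 k →+ Cochain G 𝕜 (k + 1) where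
  toFun f := f.comp (barBoundary G k)
  map_zero' := LinearMap.zero_comp _
  map_add' f f' := LinearMap.add_comp (barBoundary G k) f' f

/-- Normalized `k`-cocycles. -/
def cocycles (k : ℕ) : AddSubgroup (Cochain G 𝕜 k) := (dualBoundary G 𝕜 k).ker

/-- Normalized `k`-coboundaries. -/
def coboundaries : (k : ℕ) → AddSubgroup (Cochain G 𝕜 k)
  | 0 => ⊥
  | k + 1 => (dualBoundary G 𝕜 k).range

end Bar

/-! ### The explicit cochains -/

/-- The group `ℤ_{m_1} × ⋯ × ℤ_{m_n}`, written multiplicatively. -/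
abbrev AbGroup {n : ℕ} (m : Fin n → ℕ) : Type := (r : Fin n) → Multiplicative (ZMod (m r))

/-- The indices `r_1^{λ_1} ⋯ r_{l+1}^{λ_{l+1}}`, as triples `(l, (r, λ))` with `l + 1 ≤ k`: the `r_i`
increase strictly, `λ_i ≥ 1`, the `λ_i` add up to `k`, and `λ_1` is odd. -/
def indices (n k : ℕ) : Finset (Σ l : ℕ, (Fin (l + 1) → Fin n) × (Fin (l + 1) → ℕ)) :=
  (Finset.range k).sigma fun l =>
    (Finset.univ.filter fun r : Fin (l + 1) → Fin n => StrictMono r) ×ˢ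
      ((Finset.piAntidiag (Finset.univ : Finset (Fin (l + 1))) k).filter
        fun lam : Fin (l + 1) → ℕ => (∀ i, 1 ≤ lam i) ∧ Odd (lam 0))

/-- The parameters: integers `0 ≤ a_{r_1^{λ_1} ⋯ r_l^{λ_l}} < m_{r_1}`, one for each index. -/
abbrev Params {n : ℕ} (m : Fin n → ℕ) (k : ℕ) : Type :=
  (p : indices n k) → Fin (m (p.1.2.1 0))

/-- `η_{[a,b]}` for the modulus `M` and the sequence `α_a, …, α_b` of coordinates: the product of
the carries `⌊(α_b + α_{b-1})/M⌋ ⌊(α_{b-2} + α_{b-3})/M⌋ ⋯`, ending with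
`⌊(α_{a+1} + α_a)/M⌋` if `b - a` is odd, and with `⌊(α_{a+2} + α_{a+1})/M⌋ α_a` if it is even. -/
def eta (M : ℕ) (α : ℕ → ℕ) (a b : ℕ) : ℕ :=
  if Odd (b - a) then
    ∏ t ∈ Finset.range ((b - a + 1) / 2), (α (b - 2 * t) + α (b - 2 * t - 1)) / M
  else
    (∏ t ∈ Finset.range ((b - a) / 2), (α (b - 2 * t) + α (b - 2 * t - 1)) / M) * α a

/-- `a_u = λ_{u+1} + ⋯ + λ_l + 1`. -/
def lower {l : ℕ} (lam : Fin l → ℕ) (u : Fin l) : ℕ := ∑ i ∈ Finset.Ioi u, lam i + 1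

/-- `b_u = λ_u + ⋯ + λ_l`. -/
def upper {l : ℕ} (lam : Fin l → ℕ) (u : Fin l) : ℕ := ∑ i ∈ Finset.Ici u, lam i

/-- The integer
`(-1)^{∑_{i<j} λ_i λ_j} η_{r_1,[a_1,b_1]} ⋯ η_{r_l,[a_l,b_l]}`, where `α j r` is the exponent of
the `r`-th generator in the `j`-th argument, the arguments being numbered from `1`. -/
def exponent {n l : ℕ} (m : Fin n → ℕ) (r : Fin l → Fin n) (lam : Fin l → ℕ)
    (α : ℕ → Fin n → ℕ) : ℤ :=
  (-1) ^ (∑ j : Fin l, ∑ i ∈ Finset.Iio j, lam i * lam j) *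
    ∏ u : Fin l, (eta (m (r u)) (fun j => α j (r u)) (lower lam u) (upper lam u) : ℤ)

/-- The explicit value of the cochain with parameters `a` at `[g^{α_1}, …, g^{α_k}]`. -/
def explicitValue {𝕜 : Type*} [Field 𝕜] {n : ℕ} (m : Fin n → ℕ) (ζ : ℕ → 𝕜ˣ) (k : ℕ)
    (a : Params m k) (α : ℕ → Fin n → ℕ) : 𝕜ˣ :=
  ∏ p : indices n k,
    ζ (m (p.1.2.1 0)) ^ (exponent m p.1.2.1 p.1.2.2 α * ((a p : ℕ) : ℤ))

end BarCocycle

end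

/-! The cohomology of `G` can be read off from any free resolution of `ℤ`. A cyclic group has the
periodic one, of rank one in each degree, with boundaries alternately `g - 1` and the norm.
Tensoring these over the factors of `G` gives `Kos`, with one generator for each multidegree `λ`. On
trivial coefficients `g - 1` becomes zero and the norm becomes multiplication by `m_r`, so a cochain
is a function `u` of `λ` and its coboundary is the finite sum `cob`.

Normal forms. Since `𝕜` is algebraically closed, `𝕜ˣ` is divisible, so a coboundary can be
subtracted to make `u` vanish wherever the first nonzero entry of `λ` is even (`exists_evenZero`).
If `u` is a cocycle, its condition at `λ + e_r`, with `r` the first nonzero position of `λ` and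
`λ_r` odd, then reads `m_r u(λ) = 0`; since `m_r ∣ m_t` for `r ≤ t`, the same holds at all later
positions (`EvenZero.normal`). Conversely such normal functions are cocycles, and clearing a
primitive in the same way shows that a normal coboundary is zero (`Normal.eq_zero`). A class of
degree `k` is therefore a free choice of an `m_{r_1}`-th root of unity for each `λ` of total degree
`k` whose first nonzero entry, at `r_1`, is odd. These choices are the families `a`; the sign in the
exponent only inverts some of the roots and does not affect the count.

Transport to the bar resolution. The tensor product has a contracting homotopy `S` with `S S = 0`.
The comparison map it induces collapses to `f[h_1, …, h_k] = S(h_1 f[h_2, …, h_k])`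
(`barToKos_symbol`). Each application of `S` consumes one argument in the last slot of positive
degree. An odd degree there releases the exponent of that argument, an even degree pairs it with the
next one and releases a carry. Hence the coefficient of `λ` is the product of the `η`
(`degCoeff_barToKos`). `exists_comparison` shows that this map matches the cohomology of the two
complexes in positive degrees. -/

noncomputable section

namespace BarCocycle

set_option linter.unusedSectionVars false

/-! ### The periodic resolution of a cyclic group -/

section Cyclic

open Finset

variable {C : Type*} [CommGroup C]

open Classical in
/-- The least exponent `i` with `g ^ i = x`. -/
def dlog (g x : C) : ℕ := if h : ∃ i : ℕ, g ^ i = x then Nat.find h else 0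

lemma dlog_pow {g : C} {i : ℕ} (hi : i < orderOf g) : dlog g (g ^ i) = i := by
  classical
  have h : ∃ j : ℕ, g ^ j = g ^ i := ⟨i, rfl⟩
  rw [dlog, dif_pos h]
  have h1 : g ^ Nat.find h = g ^ i := Nat.find_spec h
  have h2 : Nat.find h ≤ i := Nat.find_min' h rfl
  exact pow_injOn_Iio_orderOf (Set.mem_Iio.2 (h2.trans_lt hi)) (Set.mem_Iio.2 hi) h1

lemma dlog_one (g : C) : dlog g 1 = 0 := by
  classical
  have h : ∃ j : ℕ, g ^ j = 1 := ⟨0, pow_zero g⟩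
  rw [dlog, dif_pos h]
  exact Nat.le_zero.1 (Nat.find_min' h (pow_zero g))

/-- `g` generates the finite cyclic group `C`. -/
structure IsGen (g : C) : Prop where
  pos : 0 < orderOf g
  mem : ∀ x : C, x ∈ Subgroup.zpowers g

lemma IsGen.exists_pow {g : C} (hg : IsGen g) (x : C) : ∃ i < orderOf g, g ^ i = x := by
  classical
  have hfin : IsOfFinOrder g := orderOf_pos_iff.1 hg.pos
  have := hfin.mem_zpowers_iff_mem_range_orderOf.1 (hg.mem x)
  simpa using this

/-- The basis element `g ^ i` in degree `j`. -/
def cyc (g : C) (j i : ℕ) : (ℕ × C) →₀ ℤ := Finsupp.single (j, g ^ i) 1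

/-- The boundary of the periodic resolution. -/
def cycD (g : C) : Module.End ℤ ((ℕ × C) →₀ ℤ) :=
  Finsupp.linearCombination ℤ fun y =>
    if y.1 = 0 then 0
    else if Odd y.1 then Finsupp.single (y.1 - 1, y.2 * g) 1 - Finsupp.single (y.1 - 1, y.2) 1
    else ∑ i ∈ range (orderOf g), Finsupp.single (y.1 - 1, y.2 * g ^ i) 1

/-- The contracting homotopy of the periodic resolution. -/
def cycS (g : C) : Module.End ℤ ((ℕ × C) →₀ ℤ) :=
  Finsupp.linearCombination ℤ fun y =>
    if Even y.1 then ∑ i ∈ range (dlog g y.2), cyc g (y.1 + 1) i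
    else if dlog g y.2 + 1 = orderOf g then cyc g (y.1 + 1) 0 else 0

variable (C) in
/-- The projection to the identity in degree zero. -/
def cycP : Module.End ℤ ((ℕ × C) →₀ ℤ) :=
  Finsupp.linearCombination ℤ fun y => if y.1 = 0 then Finsupp.single (0, 1) 1 else 0

variable (C) in
/-- The grading sign. -/
def cycSign : Module.End ℤ ((ℕ × C) →₀ ℤ) :=
  Finsupp.linearCombination ℤ fun y => (-1 : ℤ) ^ y.1 • Finsupp.single y 1

lemma IsGen.hom_ext {g : C} (hg : IsGen g) {M : Type*} [AddCommGroup M]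
    {f f' : ((ℕ × C) →₀ ℤ) →ₗ[ℤ] M}
    (h : ∀ j, ∀ i < orderOf g, f (cyc g j i) = f' (cyc g j i)) : f = f' := by
  refine Finsupp.lhom_ext' fun y => LinearMap.ext_ring ?_
  obtain ⟨i, hi, hy⟩ := hg.exists_pow y.2
  simpa [cyc, hy] using h y.1 i hi

lemma cycD_zero (g : C) (i : ℕ) : cycD g (cyc g 0 i) = 0 := by simp [cycD, cyc]

lemma cycD_odd (g : C) {j : ℕ} (hj : Even j) (i : ℕ) :
    cycD g (cyc g (j + 1) i) = cyc g j (i + 1) - cyc g j i := by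
  simp [cycD, cyc, hj.add_one, pow_succ]

/-- The norm element is invariant under translation: `i ↦ x * g ^ i` runs once through the group. -/
lemma sum_mul_pow {g : C} (hg : IsGen g) {M : Type*} [AddCommMonoid M] (x : C) (f : C → M) :
    ∑ i ∈ range (orderOf g), f (x * g ^ i) = ∑ i ∈ range (orderOf g), f (g ^ i) := by
  classical
  have key : ∀ x : C, ∑ i ∈ range (orderOf g), f (x * g ^ i) =
      ∑ y ∈ (range (orderOf g)).image (g ^ ·), f y := by
    intro x
    refine sum_bij (fun i _ => x * g ^ i) ?_ ?_ ?_ ?_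
    · intro i _
      obtain ⟨j, hj, hx⟩ := hg.exists_pow (x * g ^ i)
      exact mem_image.2 ⟨j, mem_range.2 hj, hx⟩
    · intro i hi i' hi' h
      exact pow_injOn_Iio_orderOf (by simpa using hi) (by simpa using hi') (mul_left_cancel h)
    · intro y _
      obtain ⟨j, hj, hx⟩ := hg.exists_pow (x⁻¹ * y)
      exact ⟨j, mem_range.2 hj, by rw [hx]; simp⟩
    · intros; rfl
  rw [key x, ← key 1]
  simp

lemma cycD_even {g : C} (hg : IsGen g) {j : ℕ} (hj : Odd j) (i : ℕ) :
    cycD g (cyc g (j + 1) i) = ∑ i ∈ range (orderOf g), cyc g j i := by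
  have h : ¬ Odd (j + 1) := by rw [Nat.not_odd_iff_even]; exact hj.add_one
  have := sum_mul_pow hg (g ^ i) (fun x => (Finsupp.single (j, x) 1 : (ℕ × C) →₀ ℤ))
  simp [cycD, cyc, h, this]

lemma cycS_even (g : C) {j i : ℕ} (hj : Even j) (hi : i < orderOf g) :
    cycS g (cyc g j i) = ∑ i ∈ range i, cyc g (j + 1) i := by
  simp [cycS, cyc, hj, dlog_pow hi]

lemma cycS_odd (g : C) {j i : ℕ} (hj : Odd j) (hi : i < orderOf g) :
    cycS g (cyc g j i) = if i + 1 = orderOf g then cyc g (j + 1) 0 else 0 := by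
  simp [cycS, cyc, Nat.not_even_iff_odd.2 hj, dlog_pow hi]

lemma cycP_zero (g : C) (i : ℕ) : cycP C (cyc g 0 i) = cyc g 0 0 := by simp [cycP, cyc]

lemma cycP_succ (g : C) (j i : ℕ) : cycP C (cyc g (j + 1) i) = 0 := by simp [cycP, cyc]

lemma cycSign_cyc (g : C) (j i : ℕ) : cycSign C (cyc g j i) = (-1 : ℤ) ^ j • cyc g j i := by
  simp [cycSign, cyc]

lemma cyc_orderOf (g : C) (j : ℕ) : cyc g j (orderOf g) = cyc g j 0 := by
  simp [cyc, pow_orderOf_eq_one]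

lemma cycD_mul_cycD {g : C} (hg : IsGen g) : cycD g * cycD g = 0 := by
  refine hg.hom_ext fun j i _ => ?_
  rw [Module.End.mul_apply, LinearMap.zero_apply]
  rcases j with _ | _ | j
  · rw [cycD_zero, map_zero]
  · rw [cycD_odd g Even.zero, map_sub, cycD_zero, cycD_zero, sub_zero]
  · rcases Nat.even_or_odd j with hj | hj
    · rw [cycD_even hg hj.add_one, map_sum]
      simp only [cycD_odd g hj]
      rw [sum_range_sub (fun i => cyc g j i), cyc_orderOf, sub_self]
    · rw [cycD_odd g hj.add_one, map_sub, cycD_even hg hj, cycD_even hg hj, sub_self]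

/-- From even degree, `S` produces only `g ^ i'` with `i' + 1 < orderOf g`, which the next `S`
kills; from odd degree it produces at most the identity, whose sum is empty. This vanishing is what
later gives the comparison map a one-term recursion. -/
lemma cycS_mul_cycS {g : C} (hg : IsGen g) : cycS g * cycS g = 0 := by
  refine hg.hom_ext fun j i hi => ?_
  rw [Module.End.mul_apply, LinearMap.zero_apply]
  rcases Nat.even_or_odd j with hj | hj
  · rw [cycS_even g hj hi, map_sum]
    refine sum_eq_zero fun i' hi' => ?_
    have := mem_range.1 hi'
    rw [cycS_odd g hj.add_one (by omega), if_neg (by omega)]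
  · rw [cycS_odd g hj hi]
    split_ifs
    · rw [cycS_even g hj.add_one hg.pos, range_zero, sum_empty]
    · rw [map_zero]

lemma cycP_mul_cycS {g : C} (hg : IsGen g) : cycP C * cycS g = 0 := by
  refine hg.hom_ext fun j i hi => ?_
  rw [Module.End.mul_apply, LinearMap.zero_apply]
  rcases Nat.even_or_odd j with hj | hj
  · rw [cycS_even g hj hi, map_sum]
    exact sum_eq_zero fun i' _ => cycP_succ g j i'
  · rw [cycS_odd g hj hi]
    split_ifs
    · exact cycP_succ g j 0
    · rw [map_zero]

lemma cycS_mul_cycP {g : C} (hg : IsGen g) : cycS g * cycP C = 0 := by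
  refine hg.hom_ext fun j i hi => ?_
  rw [Module.End.mul_apply, LinearMap.zero_apply]
  rcases j with _ | j
  · rw [cycP_zero, cycS_even g Even.zero hg.pos, range_zero, sum_empty]
  · rw [cycP_succ, map_zero]

lemma cycD_mul_cycP {g : C} (hg : IsGen g) : cycD g * cycP C = 0 := by
  refine hg.hom_ext fun j i hi => ?_
  rw [Module.End.mul_apply, LinearMap.zero_apply]
  rcases j with _ | j
  · rw [cycP_zero, cycD_zero]
  · rw [cycP_succ, map_zero]

lemma cycP_mul_cycD {g : C} (hg : IsGen g) : cycP C * cycD g = 0 := by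
  refine hg.hom_ext fun j i hi => ?_
  rw [Module.End.mul_apply, LinearMap.zero_apply]
  rcases j with _ | _ | j
  · rw [cycD_zero, map_zero]
  · rw [cycD_odd g Even.zero, map_sub, cycP_zero, cycP_zero, sub_self]
  · rcases Nat.even_or_odd j with hj | hj
    · rw [cycD_even hg hj.add_one, map_sum]
      exact sum_eq_zero fun i' _ => cycP_succ g j i'
    · rw [cycD_odd g hj.add_one, map_sub, cycP_succ, cycP_succ, sub_self]

/-- The boundary changes the degree by one; this is the source of the Koszul signs in the tensor
product. -/
lemma cycSign_mul_cycD {g : C} (hg : IsGen g) : cycSign C * cycD g = -(cycD g * cycSign C) := by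
  refine hg.hom_ext fun j i hi => ?_
  rw [LinearMap.neg_apply, Module.End.mul_apply, Module.End.mul_apply, cycSign_cyc, map_smul]
  rcases j with _ | j
  · rw [cycD_zero, map_zero, smul_zero, neg_zero]
  · rcases Nat.even_or_odd j with hj | hj
    · rw [cycD_odd g hj, map_sub, cycSign_cyc, cycSign_cyc, pow_succ]
      simp [smul_sub]
      abel
    · rw [cycD_even hg hj, map_sum]
      simp only [cycSign_cyc, pow_succ, smul_sum]
      simp

lemma cycSign_mul_cycS {g : C} (hg : IsGen g) : cycSign C * cycS g = -(cycS g * cycSign C) := by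
  refine hg.hom_ext fun j i hi => ?_
  rw [LinearMap.neg_apply, Module.End.mul_apply, Module.End.mul_apply, cycSign_cyc, map_smul]
  rcases Nat.even_or_odd j with hj | hj
  · rw [cycS_even g hj hi, map_sum]
    simp only [cycSign_cyc, pow_succ, smul_sum]
    simp
  · rw [cycS_odd g hj hi]
    split_ifs
    · rw [cycSign_cyc, pow_succ]
      simp
    · simp

lemma cyc_homotopy {g : C} (hg : IsGen g) :
    cycD g * cycS g + cycS g * cycD g = 1 - cycP C := by
  refine hg.hom_ext fun j i hi => ?_
  rw [LinearMap.add_apply, LinearMap.sub_apply, Module.End.mul_apply, Module.End.mul_apply,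
    Module.End.one_apply]
  rcases j with _ | j
  · rw [cycD_zero, map_zero, cycS_even g Even.zero hi, map_sum, cycP_zero, add_zero]
    simp only [cycD_odd g Even.zero]
    rw [sum_range_sub (fun i => cyc g 0 i)]
  · rw [cycP_succ, sub_zero]
    rcases Nat.even_or_odd j with hj | hj
    · rw [cycD_odd g hj, map_sub, cycS_even g hj hi, cycS_odd g hj.add_one hi]
      -- At the wrap-around, `D` lands on the identity, where `S` is zero; the missing terms are
      -- supplied by the norm `D (S (g ^ i))`.
      by_cases h : i + 1 = orderOf g
      · rw [if_pos h, h, cyc_orderOf, cycS_even g hj hg.pos, cycD_even hg hj.add_one, ← h,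
          sum_range_succ]
        simp
      · rw [if_neg h, cycS_even g hj (by omega), sum_range_succ]
        simp
    · rw [cycD_even hg hj, cycS_even g hj.add_one hi, map_sum, map_sum]
      simp only [cycD_odd g hj.add_one]
      -- Of the norm only the last power survives `S`, and it contributes the identity that cancels
      -- the lower end of the telescoping sum.
      rw [sum_range_sub (fun i => cyc g (j + 1) i), sum_eq_single (orderOf g - 1)]
      · have := hg.pos
        rw [cycS_odd g hj (by omega), if_pos (by omega)]
        simp
      · intro i' hi' h
        have := mem_range.1 hi'
        rw [cycS_odd g hj this, if_neg (by omega)]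
      · have := hg.pos
        exact fun h => absurd (mem_range.2 (by omega)) h

end Cyclic

/-! ### Operators acting on one tensor slot -/

section Slot

open Finset Function

variable {ι : Type*} [DecidableEq ι] {Y : ι → Type*}

/-- The operator on `ℤ[∏ Y_i] = ⨂ ℤ[Y_i]` acting by `f` on the slot `i`. -/
def slot (i : ι) (f : Module.End ℤ (Y i →₀ ℤ)) : Module.End ℤ ((∀ i, Y i) →₀ ℤ) :=
  Finsupp.linearCombination ℤ fun y => (f (Finsupp.single (y i) 1)).mapDomain (update y i)

lemma slot_single (i : ι) (f : Module.End ℤ (Y i →₀ ℤ)) (y : ∀ i, Y i) :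
    slot i f (Finsupp.single y 1) = (f (Finsupp.single (y i) 1)).mapDomain (update y i) := by
  simp [slot]

lemma slot_mapDomain (i : ι) (f : Module.End ℤ (Y i →₀ ℤ)) (y : ∀ i, Y i) (w : Y i →₀ ℤ) :
    slot i f (w.mapDomain (update y i)) = (f w).mapDomain (update y i) := by
  have : slot i f ∘ₗ Finsupp.lmapDomain ℤ ℤ (update y i) =
      Finsupp.lmapDomain ℤ ℤ (update y i) ∘ₗ f := by
    refine Finsupp.lhom_ext' fun a => LinearMap.ext_ring ?_
    simp only [LinearMap.comp_apply, Finsupp.lsingle_apply, Finsupp.lmapDomain_apply,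
      Finsupp.mapDomain_single, slot_single, update_self]
    congr 1
    funext b
    simp
  exact LinearMap.congr_fun this w

lemma slot_mul (i : ι) (f f' : Module.End ℤ (Y i →₀ ℤ)) :
    slot i (f * f') = slot i f * slot i f' := by
  refine Finsupp.lhom_ext' fun y => LinearMap.ext_ring ?_
  simp [slot_single, slot_mapDomain]

lemma slot_add (i : ι) (f f' : Module.End ℤ (Y i →₀ ℤ)) :
    slot i (f + f') = slot i f + slot i f' := by
  refine Finsupp.lhom_ext' fun y => LinearMap.ext_ring ?_
  simp [slot_single, Finsupp.mapDomain_add]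

lemma slot_one (i : ι) : slot i (1 : Module.End ℤ (Y i →₀ ℤ)) = 1 := by
  refine Finsupp.lhom_ext' fun y => LinearMap.ext_ring ?_
  simp [slot_single, Finsupp.mapDomain_single]

/-- `slot` as a ring homomorphism. -/
def slotHom (i : ι) : Module.End ℤ (Y i →₀ ℤ) →+* Module.End ℤ ((∀ i, Y i) →₀ ℤ) :=
  RingHom.mk' ⟨⟨slot i, slot_one i⟩, slot_mul i⟩ (slot_add i)

lemma slot_zero (i : ι) : slot i (0 : Module.End ℤ (Y i →₀ ℤ)) = 0 := map_zero (slotHom i)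

lemma slot_neg (i : ι) (f : Module.End ℤ (Y i →₀ ℤ)) : slot i (-f) = -slot i f :=
  map_neg (slotHom i) f

lemma slot_sub (i : ι) (f f' : Module.End ℤ (Y i →₀ ℤ)) :
    slot i (f - f') = slot i f - slot i f' := map_sub (slotHom i) f f'

/-- Both composites expand to the same double sum over the new values at `i` and `j`, because
updates at distinct positions commute. No sign occurs here; the signs are carried separately by
`tailSign`. -/
lemma slot_commute {i j : ι} (hij : i ≠ j) (f : Module.End ℤ (Y i →₀ ℤ))
    (f' : Module.End ℤ (Y j →₀ ℤ)) : slot i f * slot j f' = slot j f' * slot i f := by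
  have key : ∀ (i j : ι) (_ : i ≠ j) (f : Module.End ℤ (Y i →₀ ℤ)) (y : ∀ i, Y i)
      (w : Y j →₀ ℤ), slot i f (w.mapDomain (update y j)) =
        w.sum fun b n => (f (Finsupp.single (y i) 1)).sum fun a n' =>
          Finsupp.single (update (update y j b) i a) (n * n') := by
    intro i j hij f y w
    rw [Finsupp.mapDomain, map_finsuppSum]
    refine Finsupp.sum_congr fun b _ => ?_
    rw [← mul_one (w b), ← smul_eq_mul, ← Finsupp.smul_single, map_smul, slot_single,
      update_of_ne hij, Finsupp.mapDomain, Finsupp.smul_sum]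
    simp
  refine Finsupp.lhom_ext' fun y => LinearMap.ext_ring ?_
  simp only [LinearMap.comp_apply, Finsupp.lsingle_apply, Module.End.mul_apply]
  rw [slot_single j, slot_single i, key i j hij, key j i hij.symm, Finsupp.sum_comm]
  refine Finsupp.sum_congr fun a _ => Finsupp.sum_congr fun b _ => ?_
  rw [update_comm hij, mul_comm]

/-- Naturality of `slot` for slotwise maps of the basis. -/
lemma slot_natural (i : ι) (f : Module.End ℤ (Y i →₀ ℤ)) (θ : ∀ i, Y i → Y i)
    (h : ∀ w, f (w.mapDomain (θ i)) = (f w).mapDomain (θ i)) (v : (∀ i, Y i) →₀ ℤ) :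
    slot i f (v.mapDomain fun y j => θ j (y j)) =
      (slot i f v).mapDomain fun y j => θ j (y j) := by
  have : slot i f ∘ₗ Finsupp.lmapDomain ℤ ℤ (fun y j => θ j (y j)) =
      Finsupp.lmapDomain ℤ ℤ (fun y j => θ j (y j)) ∘ₗ slot i f := by
    refine Finsupp.lhom_ext' fun y => LinearMap.ext_ring ?_
    simp only [LinearMap.comp_apply, Finsupp.lsingle_apply, Finsupp.lmapDomain_apply,
      Finsupp.mapDomain_single, slot_single]
    rw [← Finsupp.mapDomain_single (f := θ i), h, ← Finsupp.mapDomain_comp,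
      ← Finsupp.mapDomain_comp]
    congr 1
    funext b j
    by_cases hj : j = i
    · subst hj; simp
    · simp [hj]
  exact LinearMap.congr_fun this v

end Slot

/-! ### The tensor product of the periodic resolutions -/

section Koszul

open Finset Function

variable {n : ℕ} {C : Fin n → Type*} [∀ r, CommGroup (C r)] (g : ∀ r, C r)

/-- The underlying abelian group of the tensor product, with basis the pairs of a multidegree and
an element of the group. -/
abbrev Tens (C : Fin n → Type*) : Type _ := (∀ r, ℕ × C r) →₀ ℤ

variable (C) in
/-- The sign `(-1)^{∑_{s > r} λ_s}`. -/
def tailSign (r : Fin n) : Module.End ℤ (Tens C) :=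
  Finsupp.linearCombination ℤ fun y => (-1 : ℤ) ^ (∑ s ∈ Ioi r, (y s).1) • Finsupp.single y 1

/-- Replace the coordinates from `j` on by the base point. -/
def resetTail (j : ℕ) (y : ∀ r, ℕ × C r) : ∀ r, ℕ × C r := fun s => if j ≤ s then (0, 1) else y s

variable (C) in
/-- The augmentation in the slots from `j` on. -/
def tailProj (j : ℕ) : Module.End ℤ (Tens C) :=
  Finsupp.linearCombination ℤ fun y =>
    if ∀ s : Fin n, j ≤ s → (y s).1 = 0 then Finsupp.single (resetTail j y) 1 else 0

lemma tailSign_single (r : Fin n) (y : ∀ r, ℕ × C r) :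
    tailSign C r (Finsupp.single y 1) =
      (-1 : ℤ) ^ (∑ s ∈ Ioi r, (y s).1) • Finsupp.single y 1 := by
  simp [tailSign]

lemma tailProj_single (j : ℕ) (y : ∀ r, ℕ × C r) :
    tailProj C j (Finsupp.single y 1) =
      if ∀ s : Fin n, j ≤ s → (y s).1 = 0 then Finsupp.single (resetTail j y) 1 else 0 := by
  simp [tailProj]

/-- The sign at `t` reads only slots strictly beyond `t`, so it does not see a change in slot `r ≤
t`. -/
lemma tailSign_commute_slot {r t : Fin n} (h : r ≤ t) (f : Module.End ℤ ((ℕ × C r) →₀ ℤ)) :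
    tailSign C t * slot r f = slot r f * tailSign C t := by
  refine Finsupp.lhom_ext' fun y => LinearMap.ext_ring ?_
  simp only [LinearMap.comp_apply, Finsupp.lsingle_apply, Module.End.mul_apply, tailSign_single,
    map_smul, slot_single]
  generalize f (Finsupp.single (y r) 1) = w
  induction w using Finsupp.induction_linear with
  | zero => simp
  | add w w' hw hw' => rw [Finsupp.mapDomain_add, map_add, hw, hw', smul_add]
  | single a c =>
    have e : ∑ s ∈ Ioi t, (update y r a s).1 = ∑ s ∈ Ioi t, (y s).1 :=
      sum_congr rfl fun s hs => by rw [update_of_ne (ne_of_gt (h.trans_lt (mem_Ioi.1 hs)))]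
    rw [Finsupp.mapDomain_single, ← mul_one c, ← smul_eq_mul, ← Finsupp.smul_single, map_smul,
      tailSign_single, smul_comm, e]

lemma tailSign_mul_slot {r t : Fin n} (h : t < r) (f : Module.End ℤ ((ℕ × C r) →₀ ℤ))
    (hf : cycSign (C r) * f = -(f * cycSign (C r))) :
    tailSign C t * slot r f = -(slot r f * tailSign C t) := by
  -- Now slot `r` is among those read by the sign, so moving the sign across costs the change of
  -- parity in that slot, recorded by conjugation with `cycSign`.
  have key : tailSign C t * slot r f = slot r (cycSign (C r) * f * cycSign (C r)) * tailSign C t := by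
    refine Finsupp.lhom_ext' fun y => LinearMap.ext_ring ?_
    simp only [LinearMap.comp_apply, Finsupp.lsingle_apply, Module.End.mul_apply, tailSign_single,
      map_smul, slot_single]
    have hy : cycSign (C r) (Finsupp.single (y r) 1) =
        (-1 : ℤ) ^ (y r).1 • Finsupp.single (y r) 1 := by simp [cycSign]
    rw [hy, map_smul, map_smul, Finsupp.mapDomain_smul, smul_smul]
    generalize f (Finsupp.single (y r) 1) = w
    induction w using Finsupp.induction_linear with
    | zero => simp
    | add w w' hw hw' => rw [Finsupp.mapDomain_add, map_add, hw, hw', map_add,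
        Finsupp.mapDomain_add, smul_add]
    | single a c =>
      have ha : cycSign (C r) (Finsupp.single a 1) =
        (-1 : ℤ) ^ a.1 • Finsupp.single a 1 := by simp [cycSign]
      have hc : Finsupp.single a c = c • Finsupp.single a (1 : ℤ) := by simp
      rw [hc]
      simp only [map_smul, Finsupp.mapDomain_smul, Finsupp.mapDomain_single, tailSign_single, ha,
        smul_smul]
      congr 1
      have e : ∑ s ∈ (Ioi t).erase r, (update y r a s).1 = ∑ s ∈ (Ioi t).erase r, (y s).1 :=
        sum_congr rfl fun s hs => by rw [update_of_ne (ne_of_mem_erase hs)]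
      rw [← add_sum_erase (Ioi t) _ (mem_Ioi.2 h),
        ← add_sum_erase (Ioi t) (fun s => (y s).1) (mem_Ioi.2 h), update_self, e, pow_add, pow_add]
      have h1 : ((-1 : ℤ) ^ (y r).1) * (-1) ^ (y r).1 = 1 := by rw [← mul_pow]; simp
      linear_combination (-c * (-1 : ℤ) ^ (∑ s ∈ (Ioi t).erase r, (y s).1) * (-1) ^ a.1) * h1
  have hs : cycSign (C r) * cycSign (C r) = 1 := by
    refine Finsupp.lhom_ext' fun y => LinearMap.ext_ring ?_
    simp [cycSign, ← mul_pow]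
  rw [key, hf, neg_mul, mul_assoc, hs, mul_one, slot_neg, neg_mul]

lemma tailProj_commute_slot {r : Fin n} {j : ℕ} (h : (r : ℕ) < j)
    (f : Module.End ℤ ((ℕ × C r) →₀ ℤ)) :
    tailProj C j * slot r f = slot r f * tailProj C j := by
  refine Finsupp.lhom_ext' fun y => LinearMap.ext_ring ?_
  simp only [LinearMap.comp_apply, Finsupp.lsingle_apply, Module.End.mul_apply, tailProj_single,
    slot_single]
  have hr : resetTail j y r = y r := by simp [resetTail, h]
  split_ifs with hy
  · rw [slot_single, hr]
    generalize f (Finsupp.single (y r) 1) = w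
    induction w using Finsupp.induction_linear with
    | zero => simp
    | add w w' hw hw' => rw [Finsupp.mapDomain_add, map_add, hw, hw', Finsupp.mapDomain_add]
    | single a c =>
      rw [Finsupp.mapDomain_single, ← mul_one c, ← smul_eq_mul, ← Finsupp.smul_single,
        ← Finsupp.smul_single, map_smul, tailProj_single, if_pos, Finsupp.mapDomain_smul,
        Finsupp.mapDomain_single]
      · congr 2
        funext s
        by_cases hs : s = r
        · subst hs; simp [resetTail, h]
        · simp [resetTail, hs]
      · intro s hs
        rw [update_of_ne (by rintro rfl; omega)]
        exact hy s hs
  · rw [map_zero]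
    generalize f (Finsupp.single (y r) 1) = w
    induction w using Finsupp.induction_linear with
    | zero => simp
    | add w w' hw hw' => rw [Finsupp.mapDomain_add, map_add, hw, hw', add_zero]
    | single a c =>
      rw [Finsupp.mapDomain_single, ← mul_one c, ← smul_eq_mul, ← Finsupp.smul_single,
        map_smul, tailProj_single, if_neg, smul_zero]
      refine fun h' => hy fun s hs => ?_
      have := h' s hs
      rwa [update_of_ne (by rintro rfl; omega)] at this

lemma slot_cycP_single (r : Fin n) (y : ∀ r, ℕ × C r) :
    slot r (cycP (C r)) (Finsupp.single y 1) =
      if (y r).1 = 0 then Finsupp.single (update y r (0, 1)) 1 else 0 := by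
  rw [slot_single]
  by_cases h : (y r).1 = 0 <;> simp [cycP, h, Finsupp.mapDomain_single]

lemma tailProj_mul_cycP {r : Fin n} {j : ℕ} (h : j ≤ r) :
    tailProj C j * slot r (cycP (C r)) = tailProj C j := by
  refine Finsupp.lhom_ext' fun y => LinearMap.ext_ring ?_
  simp only [LinearMap.comp_apply, Finsupp.lsingle_apply, Module.End.mul_apply, slot_cycP_single]
  by_cases hy : (y r).1 = 0
  · rw [if_pos hy, tailProj_single, tailProj_single]
    have e : (∀ s : Fin n, j ≤ s → (update y r (0, 1) s).1 = 0) ↔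
        ∀ s : Fin n, j ≤ s → (y s).1 = 0 := by
      refine forall_congr' fun s => ?_
      by_cases hs : s = r
      · subst hs; simp [hy]
      · simp [hs]
    have e' : resetTail j (update y r (0, 1)) = resetTail j y := by
      funext s
      by_cases hs : s = r
      · subst hs; simp [resetTail, h]
      · simp [resetTail, hs]
    simp only [e, e']
  · rw [if_neg hy, map_zero, tailProj_single, if_neg fun h' => hy (h' r h)]

lemma cycP_mul_tailProj {r : Fin n} {j : ℕ} (h : j ≤ r) :
    slot r (cycP (C r)) * tailProj C j = tailProj C j := by
  refine Finsupp.lhom_ext' fun y => LinearMap.ext_ring ?_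
  simp only [LinearMap.comp_apply, Finsupp.lsingle_apply, Module.End.mul_apply, tailProj_single]
  split_ifs
  · rw [slot_cycP_single, if_pos (by simp [resetTail, h])]
    congr 1
    refine update_eq_self_iff.2 ?_
    simp [resetTail, h]
  · rw [map_zero]

/-- Augmenting slot `r` as well moves the cut from `r + 1` to `r`; this identity makes the homotopy
formula telescope over the slots. -/
lemma tailProj_succ_mul_cycP (r : Fin n) :
    tailProj C (r + 1) * slot r (cycP (C r)) = tailProj C r := by
  refine Finsupp.lhom_ext' fun y => LinearMap.ext_ring ?_
  simp only [LinearMap.comp_apply, Finsupp.lsingle_apply, Module.End.mul_apply, slot_cycP_single]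
  have e' : resetTail (r + 1) (update y r (0, 1)) = resetTail r y := by
    funext s
    rcases lt_trichotomy s r with hs | hs | hs
    · have h1 : ¬ (r : ℕ) ≤ s := by have := Fin.lt_def.1 hs; omega
      have h2 : ¬ (r : ℕ) + 1 ≤ s := by omega
      simp only [resetTail, if_neg h1, if_neg h2, update_of_ne hs.ne]
    · subst hs; simp [resetTail]
    · have h2 : (r : ℕ) + 1 ≤ s := hs
      have h1 : (r : ℕ) ≤ s := by omega
      simp only [resetTail, if_pos h1, if_pos h2]
  by_cases hy : (y r).1 = 0
  · rw [if_pos hy, tailProj_single, tailProj_single]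
    have e : (∀ s : Fin n, (r : ℕ) + 1 ≤ s → (update y r (0, 1) s).1 = 0) ↔
        ∀ s : Fin n, (r : ℕ) ≤ s → (y s).1 = 0 := by
      constructor
      · intro h s hs
        by_cases hs' : s = r
        · rw [hs', hy]
        · have := h s (by have : (s : ℕ) ≠ r := fun h => hs' (Fin.ext h); omega)
          rwa [update_of_ne hs'] at this
      · intro h s hs
        rw [update_of_ne (by rintro rfl; omega)]
        exact h s (by omega)
    simp only [e, e']
  · rw [if_neg hy, map_zero, tailProj_single, if_neg fun h' => hy (h' r le_rfl)]

lemma tailProj_commute (i j : ℕ) : tailProj C i * tailProj C j = tailProj C j * tailProj C i := by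
  -- Either composite augments all the slots from the smaller of the two cuts on.
  have key : ∀ i j, ∀ y : ∀ r, ℕ × C r, tailProj C i (tailProj C j (Finsupp.single y 1)) =
      tailProj C (min i j) (Finsupp.single y 1) := by
    intro i j y
    rw [tailProj_single, tailProj_single]
    split_ifs with h1 h2 h2
    · have e : (∀ s : Fin n, i ≤ s → (resetTail j y s).1 = 0) := by
        intro s hs
        by_cases h : j ≤ s
        · simp [resetTail, h]
        · simpa [resetTail, h] using h2 s (by omega)
      rw [tailProj_single, if_pos e]
      congr 1
      funext s
      by_cases h : j ≤ s <;> by_cases h' : i ≤ s <;> simp [resetTail, h, h']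
    · rw [tailProj_single, if_neg]
      refine fun h => h2 fun s hs => ?_
      by_cases h' : j ≤ s
      · exact h1 s h'
      · simpa [resetTail, h'] using h s (by omega)
    · exact absurd (fun s hs => h2 s (by omega)) h1
    · rw [map_zero]
  refine Finsupp.lhom_ext' fun y => LinearMap.ext_ring ?_
  simp only [LinearMap.comp_apply, Finsupp.lsingle_apply, Module.End.mul_apply]
  rw [key, key, min_comm]

lemma tailSign_mul_tailProj {r : Fin n} {j : ℕ} (h : j ≤ r + 1) :
    tailSign C r * tailProj C j = tailProj C j := by
  refine Finsupp.lhom_ext' fun y => LinearMap.ext_ring ?_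
  simp only [LinearMap.comp_apply, Finsupp.lsingle_apply, Module.End.mul_apply, tailProj_single]
  split_ifs
  · rw [tailSign_single, sum_eq_zero, pow_zero, one_smul]
    intro s hs
    have : j ≤ s := by have := Fin.lt_def.1 (mem_Ioi.1 hs); omega
    simp [resetTail, this]
  · rw [map_zero]

lemma tailProj_mul_tailSign {r : Fin n} {j : ℕ} (h : j ≤ r + 1) :
    tailProj C j * tailSign C r = tailProj C j := by
  refine Finsupp.lhom_ext' fun y => LinearMap.ext_ring ?_
  simp only [LinearMap.comp_apply, Finsupp.lsingle_apply, Module.End.mul_apply, tailSign_single,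
    map_smul, tailProj_single]
  split_ifs with hy
  · rw [sum_eq_zero, pow_zero, one_smul]
    intro s hs
    exact hy s (by have := Fin.lt_def.1 (mem_Ioi.1 hs); omega)
  · rw [smul_zero]

lemma tailProj_last : tailProj C n = 1 := by
  refine Finsupp.lhom_ext' fun y => LinearMap.ext_ring ?_
  simp only [LinearMap.comp_apply, Finsupp.lsingle_apply, Module.End.one_apply, tailProj_single]
  rw [if_pos fun s hs => absurd s.2 (by omega)]
  congr 1
  funext s
  simp [resetTail]

lemma tailProj_mul_slot_eq_zero {r : Fin n} {j : ℕ} (h : j ≤ r)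
    {f : Module.End ℤ ((ℕ × C r) →₀ ℤ)} (hf : cycP (C r) * f = 0) :
    tailProj C j * slot r f = 0 := by
  rw [← tailProj_mul_cycP h, mul_assoc, ← slot_mul, hf, slot_zero, mul_zero]

lemma slot_mul_tailProj_eq_zero {r : Fin n} {j : ℕ} (h : j ≤ r)
    {f : Module.End ℤ ((ℕ × C r) →₀ ℤ)} (hf : f * cycP (C r) = 0) :
    slot r f * tailProj C j = 0 := by
  rw [← cycP_mul_tailProj h, ← mul_assoc, ← slot_mul, hf, slot_zero, zero_mul]

/-- The component of the boundary in the slot `r`. -/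
def tensD₁ (r : Fin n) : Module.End ℤ (Tens C) := slot r (cycD (g r)) * tailSign C r

/-- The component of the contracting homotopy in the slot `r`. -/
def tensS₁ (r : Fin n) : Module.End ℤ (Tens C) := tailProj C (r + 1) * slot r (cycS (g r))

/-- The boundary of the tensor product. -/
def tensD : Module.End ℤ (Tens C) := ∑ r, tensD₁ g r

/-- The contracting homotopy of the tensor product. -/
def tensS : Module.End ℤ (Tens C) := ∑ r, tensS₁ g r

variable {g} (hg : ∀ r, IsGen (g r))
include hg

lemma tensD₁_mul_tensD₁ (r t : Fin n) : tensD₁ g r * tensD₁ g t = -(tensD₁ g t * tensD₁ g r) := by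
  have key : ∀ r t : Fin n, r < t → tensD₁ g r * tensD₁ g t = -(tensD₁ g t * tensD₁ g r) := by
    intro r t h
    unfold tensD₁
    have hs : tailSign C r * tailSign C t = tailSign C t * tailSign C r := by
      refine Finsupp.lhom_ext' fun y => LinearMap.ext_ring ?_
      simp only [LinearMap.comp_apply, Finsupp.lsingle_apply, Module.End.mul_apply,
        tailSign_single, map_smul]
      rw [smul_comm]
    calc _ = slot r (cycD (g r)) * (tailSign C r * slot t (cycD (g t))) * tailSign C t := by
          noncomm_ring
      _ = -((slot r (cycD (g r)) * slot t (cycD (g t))) * (tailSign C r * tailSign C t)) := by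
          rw [tailSign_mul_slot h _ (cycSign_mul_cycD (hg t))]; noncomm_ring
      _ = -(slot t (cycD (g t)) * (slot r (cycD (g r)) * tailSign C t) * tailSign C r) := by
          rw [slot_commute h.ne, hs]; noncomm_ring
      _ = _ := by rw [← tailSign_commute_slot h.le]; noncomm_ring
  rcases lt_trichotomy r t with h | rfl | h
  · exact key r t h
  · unfold tensD₁
    have : slot r (cycD (g r)) * tailSign C r * (slot r (cycD (g r)) * tailSign C r) = 0 := by
      calc _ = slot r (cycD (g r)) * (tailSign C r * slot r (cycD (g r))) * tailSign C r := by
            noncomm_ring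
        _ = slot r (cycD (g r) * cycD (g r)) * (tailSign C r * tailSign C r) := by
            rw [tailSign_commute_slot le_rfl, slot_mul]; noncomm_ring
        _ = 0 := by rw [cycD_mul_cycD (hg r), slot_zero, zero_mul]
    rw [this, neg_zero]
  · rw [key t r h, neg_neg]

/-- Anticommutation of the components shows that the square equals its own negative, and integer
coefficients have no 2-torsion. -/
lemma tensD_mul_tensD : tensD g * tensD g = 0 := by
  have h : tensD g * tensD g = -(tensD g * tensD g) := by
    unfold tensD
    conv_rhs => rw [sum_mul_sum, sum_comm]
    rw [sum_mul_sum, ← sum_neg_distrib]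
    refine sum_congr rfl fun r _ => ?_
    rw [← sum_neg_distrib]
    exact sum_congr rfl fun t _ => tensD₁_mul_tensD₁ hg r t
  refine LinearMap.ext fun v => Finsupp.ext fun y => ?_
  have := DFunLike.congr_fun (LinearMap.congr_fun h v) y
  rw [LinearMap.neg_apply, Finsupp.neg_apply] at this
  rw [LinearMap.zero_apply, Finsupp.zero_apply]
  omega

/-- Each case meets one of the three side conditions of the cyclic homotopy: `P S = 0` for `r < t`,
`S S = 0` for `r = t`, `S P = 0` for `r > t`. -/
lemma tensS₁_mul_tensS₁ (r t : Fin n) : tensS₁ g r * tensS₁ g t = 0 := by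
  unfold tensS₁
  rcases lt_trichotomy r t with h | rfl | h
  · have h' : (r : ℕ) < t := h
    calc _ = tailProj C (r + 1) * (slot r (cycS (g r)) * tailProj C (t + 1)) *
          slot t (cycS (g t)) := by noncomm_ring
      _ = (tailProj C (r + 1) * tailProj C (t + 1)) * (slot r (cycS (g r)) *
          slot t (cycS (g t))) := by
          rw [← tailProj_commute_slot (by omega)]; noncomm_ring
      _ = tailProj C (t + 1) * (tailProj C (r + 1) * slot t (cycS (g t))) * slot r (cycS (g r)) := by
          rw [tailProj_commute, slot_commute h.ne]; noncomm_ring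
      _ = 0 := by
          rw [tailProj_mul_slot_eq_zero (by omega) (cycP_mul_cycS (hg t)), mul_zero, zero_mul]
  · calc _ = tailProj C (r + 1) * (slot r (cycS (g r)) * tailProj C (r + 1)) *
          slot r (cycS (g r)) := by noncomm_ring
      _ = tailProj C (r + 1) * tailProj C (r + 1) * slot r (cycS (g r) * cycS (g r)) := by
          rw [← tailProj_commute_slot (by omega), slot_mul]; noncomm_ring
      _ = 0 := by rw [cycS_mul_cycS (hg r), slot_zero, mul_zero]
  · have h' : (t : ℕ) < r := h
    calc _ = tailProj C (r + 1) * (slot r (cycS (g r)) * tailProj C (t + 1)) *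
          slot t (cycS (g t)) := by noncomm_ring
      _ = 0 := by
          rw [slot_mul_tailProj_eq_zero (by omega) (cycS_mul_cycP (hg r)), mul_zero, zero_mul]

lemma tensS_mul_tensS : tensS g * tensS g = 0 := by
  unfold tensS
  rw [sum_mul_sum]
  exact sum_eq_zero fun r _ => sum_eq_zero fun t _ => tensS₁_mul_tensS₁ hg r t

lemma tailProj_zero_mul_tensS : tailProj C 0 * tensS g = 0 := by
  unfold tensS tensS₁
  rw [mul_sum]
  refine sum_eq_zero fun r _ => ?_
  rw [← mul_assoc, tailProj_commute, mul_assoc,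
    tailProj_mul_slot_eq_zero (Nat.zero_le _) (cycP_mul_cycS (hg r)), mul_zero]

lemma tailProj_zero_mul_tensD : tailProj C 0 * tensD g = 0 := by
  unfold tensD tensD₁
  rw [mul_sum]
  refine sum_eq_zero fun r _ => ?_
  rw [← mul_assoc, tailProj_mul_slot_eq_zero (Nat.zero_le _) (cycP_mul_cycD (hg r)), zero_mul]

/-- The sign in the boundary at `t` reads slot `r`, whose degree is raised by one by the homotopy;
the two operators therefore anticommute. -/
lemma tens_homotopy_of_lt {t r : Fin n} (h : t < r) :
    tensD₁ g t * tensS₁ g r + tensS₁ g r * tensD₁ g t = 0 := by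
  unfold tensS₁ tensD₁
  have h' : (t : ℕ) < r := h
  -- Where `tailProj` is nonzero, the slots that it resets already have degree zero, so the sign is
  -- unchanged.
  have hQ : tailSign C t * tailProj C (r + 1) = tailProj C (r + 1) * tailSign C t := by
    refine Finsupp.lhom_ext' fun y => LinearMap.ext_ring ?_
    simp only [LinearMap.comp_apply, Finsupp.lsingle_apply, Module.End.mul_apply,
      tailSign_single, map_smul, tailProj_single]
    split_ifs with hy
    · rw [tailSign_single]
      congr 2
      refine sum_congr rfl fun s _ => ?_
      by_cases hs : (r : ℕ) + 1 ≤ s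
      · simp [resetTail, hs, hy s hs]
      · simp [resetTail, hs]
    · simp
  have e : slot t (cycD (g t)) * tailSign C t * (tailProj C (r + 1) * slot r (cycS (g r))) =
      -(tailProj C (r + 1) * slot r (cycS (g r)) * (slot t (cycD (g t)) * tailSign C t)) := by
    calc _ = slot t (cycD (g t)) * (tailSign C t * tailProj C (r + 1)) * slot r (cycS (g r)) := by
          noncomm_ring
      _ = (slot t (cycD (g t)) * tailProj C (r + 1)) * (tailSign C t * slot r (cycS (g r))) := by
          rw [hQ]; noncomm_ring
      _ = -(tailProj C (r + 1) * (slot t (cycD (g t)) * slot r (cycS (g r))) * tailSign C t) := by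
          rw [tailSign_mul_slot h _ (cycSign_mul_cycS (hg r)),
            ← tailProj_commute_slot (by omega)]
          noncomm_ring
      _ = _ := by rw [slot_commute h.ne]; noncomm_ring
  rw [e, neg_add_cancel]

/-- Once all slots beyond `t` are augmented the sign is trivial, and what remains is the cyclic
identity `D S + S D = 1 - P` in slot `t`. -/
lemma tens_homotopy_self (t : Fin n) : tensD₁ g t * tensS₁ g t + tensS₁ g t * tensD₁ g t =
    tailProj C (t + 1) - tailProj C t := by
  unfold tensS₁ tensD₁
  have h1 : tailSign C t * tailProj C (t + 1) = tailProj C (t + 1) :=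
    tailSign_mul_tailProj le_rfl
  have h2 : tailProj C (t + 1) * tailSign C t = tailProj C (t + 1) :=
    tailProj_mul_tailSign le_rfl
  have h3 := tailSign_commute_slot (le_refl t) (cycS (g t) * cycD (g t))
  have h4 : tailProj C (t + 1) * slot t (cycD (g t)) = slot t (cycD (g t)) * tailProj C (t + 1) :=
    tailProj_commute_slot (Nat.lt_succ_self _) _
  have h5 := cyc_homotopy (hg t)
  have h6 : tailProj C (t + 1) * slot t (cycP (C t)) = tailProj C t := tailProj_succ_mul_cycP t
  have e₁ : slot t (cycD (g t)) * tailSign C t * (tailProj C (t + 1) * slot t (cycS (g t))) =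
      tailProj C (t + 1) * slot t (cycD (g t) * cycS (g t)) := by
    rw [mul_assoc, ← mul_assoc (tailSign C t), h1, ← mul_assoc, ← h4, mul_assoc, slot_mul]
  have e₂ : tailProj C (t + 1) * slot t (cycS (g t)) * (slot t (cycD (g t)) * tailSign C t) =
      tailProj C (t + 1) * slot t (cycS (g t) * cycD (g t)) := by
    rw [slot_mul] at h3 ⊢
    rw [mul_assoc, ← mul_assoc _ _ (tailSign C t), ← h3, ← mul_assoc, h2]
  rw [e₁, e₂, ← mul_add, ← slot_add, h5, slot_sub, slot_one, mul_sub, mul_one, h6]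

/-- The homotopy at `r` augments slot `t`, and `D P = P D = 0` there, so each term vanishes by
itself. -/
lemma tens_homotopy_of_gt {t r : Fin n} (h : r < t) :
    tensD₁ g t * tensS₁ g r + tensS₁ g r * tensD₁ g t = 0 := by
  unfold tensS₁ tensD₁
  have h' : (r : ℕ) < t := h
  have e₁ : slot t (cycD (g t)) * tailSign C t * (tailProj C (r + 1) * slot r (cycS (g r))) =
      0 := by
    calc _ = slot t (cycD (g t)) * (tailSign C t * tailProj C (r + 1)) * slot r (cycS (g r)) := by
          noncomm_ring
      _ = 0 := by rw [tailSign_mul_tailProj (by omega),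
          slot_mul_tailProj_eq_zero (by omega) (cycD_mul_cycP (hg t)), zero_mul]
  have e₂ : tailProj C (r + 1) * slot r (cycS (g r)) * (slot t (cycD (g t)) * tailSign C t) =
      0 := by
    calc _ = tailProj C (r + 1) * (slot r (cycS (g r)) * slot t (cycD (g t))) * tailSign C t := by
          noncomm_ring
      _ = (tailProj C (r + 1) * slot t (cycD (g t))) * slot r (cycS (g r)) * tailSign C t := by
          rw [slot_commute h.ne]; noncomm_ring
      _ = 0 := by
          rw [tailProj_mul_slot_eq_zero (by omega) (cycP_mul_cycD (hg t)), zero_mul, zero_mul]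
  rw [e₁, e₂, add_zero]

lemma tens_homotopy₁ (t r : Fin n) : tensD₁ g t * tensS₁ g r + tensS₁ g r * tensD₁ g t =
    if t = r then tailProj C (r + 1) - tailProj C r else 0 := by
  rcases lt_trichotomy t r with h | rfl | h
  · rw [if_neg h.ne, tens_homotopy_of_lt hg h]
  · rw [if_pos rfl, tens_homotopy_self hg]
  · rw [if_neg h.ne', tens_homotopy_of_gt hg h]

lemma tens_homotopy : tensD g * tensS g + tensS g * tensD g = 1 - tailProj C 0 := by
  unfold tensD tensS
  rw [sum_mul_sum, sum_mul_sum, sum_comm, ← sum_add_distrib]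
  simp only [← sum_add_distrib, tens_homotopy₁ hg]
  simp only [sum_ite_eq', mem_univ, if_true]
  rw [Fin.sum_univ_eq_sum_range (fun r => tailProj C (r + 1) - tailProj C r) n,
    sum_range_sub, tailProj_last]

end Koszul

/-! ### Formulas for the boundary and the homotopy in terms of multidegrees -/

section KoszulFormulas

open Finset Function

variable {n : ℕ} {C : Fin n → Type*} [∀ r, CommGroup (C r)] (g : ∀ r, C r)

/-- The multidegree of a basis element. -/
def deg (y : ∀ r, ℕ × C r) (r : Fin n) : ℕ := (y r).1

/-- Lower the multidegree in the slot `r`. -/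
def lowerAt (r : Fin n) (lam : Fin n → ℕ) : Fin n → ℕ := update lam r (lam r - 1)

lemma deg_update (y : ∀ r, ℕ × C r) (r : Fin n) (a : ℕ × C r) :
    deg (update y r a) = update (deg y) r a.1 := by
  funext s
  by_cases hs : s = r
  · subst hs; simp [deg]
  · simp [deg, hs]

lemma sum_lowerAt {lam : Fin n → ℕ} {r : Fin n} (h : lam r ≠ 0) :
    ∑ s, lowerAt r lam s + 1 = ∑ s, lam s := by
  have e : ∑ s ∈ univ.erase r, lowerAt r lam s = ∑ s ∈ univ.erase r, lam s :=
    sum_congr rfl fun s hs => update_of_ne (ne_of_mem_erase hs) _ _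
  have e' : lowerAt r lam r = lam r - 1 := update_self ..
  rw [← add_sum_erase univ _ (mem_univ r), ← add_sum_erase univ lam (mem_univ r), e, e']
  omega

lemma map_slot_single {M : Type*} [AddCommGroup M] (Φ : Tens C →ₗ[ℤ] M) (r : Fin n)
    (f : Module.End ℤ ((ℕ × C r) →₀ ℤ)) (y : ∀ r, ℕ × C r) :
    Φ (slot r f (Finsupp.single y 1)) =
      Finsupp.linearCombination ℤ (fun a => Φ (Finsupp.single (update y r a) 1))
        (f (Finsupp.single (y r) 1)) := by
  rw [slot_single]
  generalize f (Finsupp.single (y r) 1) = w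
  induction w using Finsupp.induction_linear with
  | zero => simp
  | add w w' hw hw' => rw [Finsupp.mapDomain_add, map_add, hw, hw', map_add]
  | single a c =>
    rw [Finsupp.mapDomain_single, ← mul_one c, ← smul_eq_mul, ← Finsupp.smul_single,
      ← Finsupp.smul_single, map_smul, map_smul]
    simp

/-- The boundary seen through a map which depends only on the multidegree. -/
lemma map_tensD {M : Type*} [AddCommGroup M] (u : (Fin n → ℕ) → M) (y : ∀ r, ℕ × C r) :
    Finsupp.linearCombination ℤ (fun y => u (deg y)) (tensD g (Finsupp.single y 1)) =
      ∑ r, if deg y r ≠ 0 ∧ Even (deg y r) then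
        (-1 : ℤ) ^ (∑ s ∈ Ioi r, deg y s) • orderOf (g r) • u (lowerAt r (deg y)) else 0 := by
  rw [tensD, LinearMap.sum_apply, map_sum]
  refine sum_congr rfl fun r _ => ?_
  rw [tensD₁, Module.End.mul_apply, tailSign_single, map_smul, map_smul, map_slot_single]
  have hd : ∀ s, (y s).1 = deg y s := fun _ => rfl
  by_cases h0 : deg y r = 0
  · simp [cycD, hd, h0]
  · rcases Nat.even_or_odd (deg y r) with h | h
    · simp [cycD, hd, h0, h, Nat.not_odd_iff_even.2 h, deg_update, lowerAt]
    · simp [cycD, hd, h0, h, Nat.not_even_iff_odd.2 h, deg_update]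

variable (C) in
/-- The projection to the total degree `k`. -/
def degProj (k : ℕ) : Module.End ℤ (Tens C) :=
  Finsupp.linearCombination ℤ fun y => if ∑ r, deg y r = k then Finsupp.single y 1 else 0

lemma degProj_single (k : ℕ) (y : ∀ r, ℕ × C r) : degProj C k (Finsupp.single y 1) =
    if ∑ r, deg y r = k then Finsupp.single y 1 else 0 := by simp [degProj]

lemma degProj_tensD (k : ℕ) : degProj C k * tensD g = tensD g * degProj C (k + 1) := by
  refine Finsupp.lhom_ext' fun y => LinearMap.ext_ring ?_
  simp only [LinearMap.comp_apply, Finsupp.lsingle_apply, Module.End.mul_apply]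
  rw [tensD, LinearMap.sum_apply, LinearMap.sum_apply, map_sum]
  refine sum_congr rfl fun r _ => ?_
  rw [tensD₁, Module.End.mul_apply, Module.End.mul_apply, tailSign_single, map_smul, map_smul,
    degProj_single]
  have key : degProj C k (slot r (cycD (g r)) (Finsupp.single y 1)) =
      if ∑ r, deg y r = k + 1 then slot r (cycD (g r)) (Finsupp.single y 1) else 0 := by
    have e := map_slot_single LinearMap.id r (cycD (g r)) y
    rw [LinearMap.id_apply] at e
    rw [map_slot_single, e]
    have hd : (y r).1 = deg y r := rfl
    by_cases h0 : deg y r = 0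
    · simp [cycD, hd, h0]
    · have hs : ∀ a : C r, (∑ s, deg (update y r (deg y r - 1, a)) s = k) ↔
          ∑ s, deg y s = k + 1 := by
        intro a
        have := sum_lowerAt (lam := deg y) h0
        rw [deg_update]
        rw [lowerAt] at this
        simp only
        omega
      rcases Nat.even_or_odd (deg y r) with h | h
      · simp only [cycD, hd, Finsupp.linearCombination_single, one_smul, h0, if_false,
          Nat.not_odd_iff_even.2 h, map_sum, degProj_single, hs, LinearMap.id_apply]
        split_ifs <;> simp
      · simp only [cycD, hd, Finsupp.linearCombination_single, one_smul, h0, if_false,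
          h, if_true, map_sub, degProj_single, hs, LinearMap.id_apply]
        split_ifs <;> simp
  rw [key]
  split_ifs
  · rw [tailSign_single, map_smul]
  · simp

/-- Translation by an element of the group. -/
def translate (x : ∀ r, C r) (y : ∀ r, ℕ × C r) : ∀ r, ℕ × C r := fun r => ((y r).1, x r * (y r).2)

/-- The boundary is equivariant and descends to the group ring. The homotopy is not, because it
depends on discrete logarithms. -/
lemma tensD_translate (x : ∀ r, C r) (v : Tens C) :
    tensD g (v.mapDomain (translate x)) = (tensD g v).mapDomain (translate x) := by
  have hc : ∀ r (w : (ℕ × C r) →₀ ℤ), cycD (g r) (w.mapDomain fun a => (a.1, x r * a.2)) =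
      (cycD (g r) w).mapDomain fun a => (a.1, x r * a.2) := by
    intro r w
    have : cycD (g r) ∘ₗ Finsupp.lmapDomain ℤ ℤ (fun a : ℕ × C r => (a.1, x r * a.2)) =
        Finsupp.lmapDomain ℤ ℤ (fun a : ℕ × C r => (a.1, x r * a.2)) ∘ₗ cycD (g r) := by
      refine Finsupp.lhom_ext' fun a => LinearMap.ext_ring ?_
      by_cases h0 : a.1 = 0
      · simp [cycD, h0]
      · by_cases h : Odd a.1
        · simp [cycD, h0, h, mul_assoc, sub_eq_add_neg, ← Finsupp.single_neg, Finsupp.mapDomain_add]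
        · simp [cycD, h0, h, mul_assoc]
    exact LinearMap.congr_fun this w
  have hs : ∀ r (v : Tens C), tailSign C r (v.mapDomain (translate x)) =
      (tailSign C r v).mapDomain (translate x) := by
    intro r v
    have : tailSign C r ∘ₗ Finsupp.lmapDomain ℤ ℤ (translate x) =
        Finsupp.lmapDomain ℤ ℤ (translate x) ∘ₗ tailSign C r := by
      refine Finsupp.lhom_ext' fun a => LinearMap.ext_ring ?_
      simp only [LinearMap.comp_apply, Finsupp.lsingle_apply, Finsupp.lmapDomain_apply,
        Finsupp.mapDomain_single, tailSign_single, Finsupp.mapDomain_smul]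
      rfl
    exact LinearMap.congr_fun this v
  rw [tensD, LinearMap.sum_apply, LinearMap.sum_apply, Finsupp.mapDomain_finsetSum]
  refine sum_congr rfl fun r _ => ?_
  rw [tensD₁, Module.End.mul_apply, hs, Module.End.mul_apply]
  exact slot_natural r (cycD (g r)) (fun r a => (a.1, x r * a.2)) (hc r) _

lemma tensS_single (y : ∀ r, ℕ × C r) : tensS g (Finsupp.single y 1) =
    ∑ r : Fin n, if ∀ s, r < s → deg y s = 0 then
      slot r (cycS (g r)) (Finsupp.single (resetTail (r + 1) y) 1) else 0 := by
  rw [tensS, LinearMap.sum_apply]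
  refine sum_congr rfl fun r _ => ?_
  rw [tensS₁, tailProj_commute_slot (Nat.lt_succ_self _), Module.End.mul_apply, tailProj_single]
  have : (∀ s : Fin n, (r : ℕ) + 1 ≤ s → (y s).1 = 0) ↔ ∀ s, r < s → deg y s = 0 := Iff.rfl
  simp only [this]
  split_ifs
  · rfl
  · rw [map_zero]

lemma cycS_mem_supported (r : Fin n) (a : ℕ × C r) :
    cycS (g r) (Finsupp.single a 1) ∈
      Finsupp.supported ℤ ℤ {b : ℕ × C r | b.1 = a.1 + 1 ∧ (Even b.1 → b.2 = 1)} := by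
  have e : ∀ (i : ℕ), (Even (a.1 + 1) → g r ^ i = 1) → cyc (g r) (a.1 + 1) i ∈
      Finsupp.supported ℤ ℤ {b : ℕ × C r | b.1 = a.1 + 1 ∧ (Even b.1 → b.2 = 1)} :=
    fun i hi => Finsupp.single_mem_supported ℤ _ ⟨rfl, hi⟩
  rw [cycS, Finsupp.linearCombination_single, one_smul]
  split_ifs with h1 h2
  · refine Submodule.sum_mem _ fun i _ => e i fun h => ?_
    exact absurd h (Nat.not_even_iff_odd.2 h1.add_one)
  · exact e 0 fun _ => pow_zero _
  · exact Submodule.zero_mem _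

variable (C) in
/-- The span of the basis elements whose coordinate `r` is trivial whenever the multidegree is even
at `r` and vanishes beyond `r`. -/
def settled : Submodule ℤ (Tens C) :=
  Finsupp.supported ℤ ℤ
    {y | ∀ r, Even (deg y r) → (∀ s, r < s → deg y s = 0) → (y r).2 = 1}

/-- In the component at `t` the slots beyond `t` are reset to the identity, slot `t` carries the
identity if its new degree is even, and slots before `t` are exempt since slot `t` has positive
degree. -/
lemma tensS_mem_settled (v : Tens C) : tensS g v ∈ settled C := by
  induction v using Finsupp.induction_linear with
  | zero => rw [map_zero]; exact Submodule.zero_mem _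
  | add v v' hv hv' => rw [map_add]; exact Submodule.add_mem _ hv hv'
  | single y c =>
    rw [← mul_one c, ← smul_eq_mul, ← Finsupp.smul_single, map_smul, tensS_single]
    refine Submodule.smul_mem _ _ (Submodule.sum_mem _ fun t _ => ?_)
    split_ifs with h0
    · have e := map_slot_single LinearMap.id t (cycS (g t)) (resetTail (t + 1) y)
      rw [LinearMap.id_apply] at e
      rw [e, Finsupp.linearCombination_apply]
      refine Submodule.sum_mem _ fun a ha => Submodule.smul_mem _ _ ?_
      obtain ⟨ha, ha'⟩ := cycS_mem_supported g t _ ha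
      refine Finsupp.single_mem_supported ℤ _ fun r hr hs => ?_
      rcases lt_trichotomy r t with hlt | rfl | hlt
      · have := hs t hlt
        rw [deg_update, update_self] at this
        omega
      · rw [deg_update, update_self] at hr
        rw [update_self, ha' hr]
      · rw [update_of_ne hlt.ne']
        have h1 : (t : ℕ) + 1 ≤ r := hlt
        simp [resetTail, h1]
    · exact Submodule.zero_mem _

/-- The functional `∑ c_y y ↦ ∑_{deg y = λ} c_y τ(y_r)`. -/
def fiber (lam : Fin n → ℕ) (r : Fin n) (τ : C r → ℤ) : Tens C →ₗ[ℤ] ℤ :=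
  Finsupp.linearCombination ℤ fun y => if deg y = lam then τ (y r).2 else 0

lemma fiber_single (lam : Fin n → ℕ) (r : Fin n) (τ : C r → ℤ) (y : ∀ r, ℕ × C r) :
    fiber lam r τ (Finsupp.single y 1) = if deg y = lam then τ (y r).2 else 0 := by
  simp [fiber]

lemma fiber_translate (lam : Fin n → ℕ) (r : Fin n) (τ : C r → ℤ) (x : ∀ r, C r) (v : Tens C) :
    fiber lam r τ (v.mapDomain (translate x)) = fiber lam r (fun b => τ (x r * b)) v := by
  have : fiber lam r τ ∘ₗ Finsupp.lmapDomain ℤ ℤ (translate x) =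
      fiber lam r (fun b => τ (x r * b)) := by
    refine Finsupp.lhom_ext' fun y => LinearMap.ext_ring ?_
    simp only [LinearMap.comp_apply, Finsupp.lsingle_apply, Finsupp.lmapDomain_apply,
      Finsupp.mapDomain_single, fiber_single]
    rfl
  exact LinearMap.congr_fun this v

/-- Every basis element that contributes has the identity in slot `r`, so `τ` is only evaluated at
`1`. This turns a weighted sum of coefficients into a plain one. -/
lemma fiber_settled {lam : Fin n → ℕ} {r : Fin n} (hr : Even (lam r))
    (h : ∀ s, r < s → lam s = 0) (τ : C r → ℤ) {v : Tens C} (hv : v ∈ settled C) :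
    fiber lam r τ v = τ 1 * fiber lam r 1 v := by
  rw [fiber, fiber, Finsupp.linearCombination_apply, Finsupp.linearCombination_apply,
    Finsupp.sum, Finsupp.sum, mul_sum]
  refine sum_congr rfl fun y hy => ?_
  split_ifs with hd
  · have := hv hy r (by rw [hd]; exact hr) (by rw [hd]; exact h)
    rw [this, smul_eq_mul, smul_eq_mul, Pi.one_apply, mul_one, mul_comm]
  · simp

/-- This is the transpose of the homotopy: when `r` is the last nonzero position of `lam`, only its
component at `r` reaches multidegree `lam`, and the effect on the weight `τ` is that of the cyclic
homotopy. -/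
lemma fiber_tensS {lam : Fin n → ℕ} {r : Fin n} (hr : lam r ≠ 0) (h : ∀ s, r < s → lam s = 0)
    (τ : C r → ℤ) (v : Tens C) : fiber lam r τ (tensS g v) =
      fiber (lowerAt r lam) r (fun b => if Odd (lam r) then
        ∑ i ∈ range (dlog (g r) b), τ (g r ^ i) else
        if dlog (g r) b + 1 = orderOf (g r) then τ 1 else 0) v := by
  have : fiber lam r τ ∘ₗ tensS g = fiber (lowerAt r lam) r (fun b => if Odd (lam r) then
        ∑ i ∈ range (dlog (g r) b), τ (g r ^ i) else
        if dlog (g r) b + 1 = orderOf (g r) then τ 1 else 0) := by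
    refine Finsupp.lhom_ext' fun y => LinearMap.ext_ring ?_
    simp only [LinearMap.comp_apply, Finsupp.lsingle_apply]
    rw [tensS_single, map_sum, sum_eq_single r]
    · rw [fiber_single]
      by_cases hd : deg y = lowerAt r lam
      · have h0 : ∀ s, r < s → deg y s = 0 := fun s hs => by
          rw [hd, lowerAt, update_of_ne hs.ne', h s hs]
        have hj : (y r).1 + 1 = lam r := by
          have : (y r).1 = lowerAt r lam r := congr_fun hd r
          rw [this, lowerAt, update_self]; omega
        have hy : resetTail (r + 1) y r = y r := by simp [resetTail]
        have hd' : ∀ b, deg (update (resetTail (r + 1) y) r ((y r).1 + 1, b)) = lam := by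
          intro b
          rw [deg_update]
          funext s
          by_cases hs : s = r
          · subst hs; simpa using hj
          · rw [update_of_ne hs]
            by_cases hs' : r < s
            · have : (r : ℕ) + 1 ≤ s := hs'
              simp [deg, resetTail, this, h s hs']
            · have : ¬ (r : ℕ) + 1 ≤ s := hs'
              have e : deg y s = lam s := by rw [hd, lowerAt, update_of_ne hs]
              simpa [deg, resetTail, this] using e
        rw [if_pos h0, if_pos hd, map_slot_single, hy, ← hj]
        simp only [fiber_single]
        by_cases he : Even (y r).1
        · simp [cycS, cyc, he, he.add_one, hd']
        · have ho := Nat.not_even_iff_odd.1 he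
          have ho' : ¬ Odd ((y r).1 + 1) := Nat.not_odd_iff_even.2 ho.add_one
          simp only [cycS, cyc, he, ho', if_false, Finsupp.linearCombination_single, one_smul]
          split_ifs <;> simp [hd']
      · rw [if_neg hd]
        split_ifs with h0
        · rw [map_slot_single]
          refine (Finsupp.linearCombination_apply ℤ _).trans (sum_eq_zero fun a ha => ?_)
          have ha := (cycS_mem_supported g r _ ha).1
          beta_reduce
          rw [fiber_single, if_neg, smul_zero]
          intro hd'
          apply hd
          have hy : resetTail (r + 1) y r = y r := by simp [resetTail]
          rw [hy] at ha
          rw [deg_update] at hd'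
          funext s
          have hs' := congr_fun hd' s
          by_cases hs : s = r
          · subst hs
            rw [update_self, ha] at hs'
            rw [lowerAt, update_self, ← hs']
            rfl
          · rw [update_of_ne hs] at hs'
            rw [lowerAt, update_of_ne hs]
            by_cases hlt : r < s
            · rw [h s hlt, h0 s hlt]
            · have : ¬ (r : ℕ) + 1 ≤ s := hlt
              simpa [deg, resetTail, this] using hs'
        · rw [map_zero]
    -- For `t < r` the output has degree zero at `r`, where `lam` does not vanish; for `t > r` it
    -- has positive degree at `t`, where `lam` vanishes.
    · intro t _ ht
      split_ifs with h0
      · rw [map_slot_single]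
        refine (Finsupp.linearCombination_apply ℤ _).trans (sum_eq_zero fun a ha => ?_)
        have ha := (cycS_mem_supported g t _ ha).1
        beta_reduce
        rw [fiber_single, if_neg, smul_zero]
        intro hd'
        rw [deg_update] at hd'
        rcases lt_or_gt_of_ne ht with hlt | hlt
        · have := congr_fun hd' r
          rw [update_of_ne hlt.ne'] at this
          have h1 : (t : ℕ) + 1 ≤ r := hlt
          simp [deg, resetTail, h1] at this
          omega
        · have := congr_fun hd' t
          rw [update_self, h t hlt] at this
          omega
      · rw [map_zero]
    · simp
  exact LinearMap.congr_fun this v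

end KoszulFormulas

/-! ### Comparison of free complexes -/

section Comparison

/-- Dependent choice with an invariant `Q` that guarantees that each next step is possible. -/
lemma exists_dependent_seq {T : ℕ → Type*} (Q : ∀ k, T k → Prop) (Rel : ∀ k, T k → T (k + 1) → Prop)
    (t₀ : T 0) (h₀ : Q 0 t₀) (step : ∀ k t, Q k t → ∃ t', Rel k t t' ∧ Q (k + 1) t') :
    ∃ f : ∀ k, T k, f 0 = t₀ ∧ ∀ k, Rel k (f k) (f (k + 1)) := by
  choose next hrel hQ using step
  let F : ∀ k, {t : T k // Q k t} := fun k =>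
    Nat.rec (motive := fun k => {t : T k // Q k t}) ⟨t₀, h₀⟩
      (fun k t => ⟨next k t.1 t.2, hQ k t.1 t.2⟩) k
  exact ⟨fun k => (F k).1, rfl, fun k => hrel k (F k).1 (F k).2⟩

variable {R : Type*} [Ring R]

lemma exists_lift_of_mem {X N N' : Type*} [AddCommGroup N] [Module R N] [AddCommGroup N']
    [Module R N'] (d : N' →ₗ[R] N) (f : (X →₀ R) →ₗ[R] N) (S : Submodule R N')
    (h : ∀ x, ∃ z ∈ S, d z = f x) :
    ∃ l : (X →₀ R) →ₗ[R] N', (∀ x, d (l x) = f x) ∧ ∀ x, l x ∈ S := by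
  choose z hzS hz using h
  refine ⟨Finsupp.linearCombination R fun i => z (Finsupp.single i 1), fun x => ?_, fun x => ?_⟩
  · refine LinearMap.congr_fun (f := d ∘ₗ Finsupp.linearCombination R _) ?_ x
    refine Finsupp.lhom_ext' fun i => LinearMap.ext_ring ?_
    simp [hz]
  · rw [Finsupp.linearCombination_apply]
    exact Submodule.sum_mem _ fun i _ => S.smul_mem _ (hzS _)

variable {X : ℕ → Type*} {N : ℕ → Type*} [∀ k, AddCommGroup (N k)] [∀ k, Module R (N k)]
  (dM : ∀ k, (X (k + 1) →₀ R) →ₗ[R] (X k →₀ R)) (dN : ∀ k, N (k + 1) →ₗ[R] N k)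

lemma exists_chainMap (hM : ∀ k x, dM k (dM (k + 1) x) = 0)
    (hex : ∀ k y, dN k y = 0 → ∃ z, dN (k + 1) z = y)
    (f₀ : (X 0 →₀ R) →ₗ[R] N 0) (h₀ : ∀ x, ∃ z, dN 0 z = f₀ (dM 0 x)) :
    ∃ f : ∀ k, (X k →₀ R) →ₗ[R] N k, f 0 = f₀ ∧ ∀ k x, dN k (f (k + 1) x) = f k (dM k x) := by
  refine exists_dependent_seq (T := fun k => (X k →₀ R) →ₗ[R] N k)
    (fun k f => ∀ x, ∃ z, dN k z = f (dM k x))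
    (fun k f f' => ∀ x, dN k (f' x) = f (dM k x)) f₀ h₀ fun k f hf => ?_
  obtain ⟨l, hl, -⟩ := exists_lift_of_mem (dN k) (f ∘ₗ dM k) ⊤
    (fun x => (hf x).imp fun z hz => ⟨trivial, hz⟩)
  refine ⟨l, hl, fun x => hex k _ ?_⟩
  rw [hl, LinearMap.comp_apply, hM, map_zero]

/-- Exactness of the target is required only inside the submodules `S k`. This allows the ungraded
module `Kos` to serve in every degree, with `S k` the kernel of the augmentation. -/
lemma exists_nullHomotopy (hM : ∀ k x, dM k (dM (k + 1) x) = 0) (S : ∀ k, Submodule R (N k))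
    (hex : ∀ k, ∀ y ∈ S (k + 1), dN k y = 0 → ∃ z ∈ S (k + 2), dN (k + 1) z = y)
    (f : ∀ k, (X k →₀ R) →ₗ[R] N k) (hf : ∀ k x, dN k (f (k + 1) x) = f k (dM k x))
    (hf₀ : f 0 = 0) (hfS : ∀ k x, f (k + 1) x ∈ S (k + 1)) :
    ∃ H : ∀ k, (X k →₀ R) →ₗ[R] N (k + 1),
      ∀ k x, f (k + 1) x = dN (k + 1) (H (k + 1) x) + H k (dM k x) := by
  obtain ⟨H, -, hH⟩ := exists_dependent_seq (T := fun k => (X k →₀ R) →ₗ[R] N (k + 1))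
    (fun k H => (∀ x, H x ∈ S (k + 1)) ∧ ∀ x, dN k (H (dM k x)) = f k (dM k x))
    (fun k H H' => ∀ x, f (k + 1) x = dN (k + 1) (H' x) + H (dM k x)) 0
    ⟨fun x => (S 1).zero_mem, fun x => by simp [hf₀]⟩ fun k H hH => by
      obtain ⟨hHS, hH⟩ := hH
      obtain ⟨l, hl, hlS⟩ := exists_lift_of_mem (dN (k + 1)) (f (k + 1) - H ∘ₗ dM k) (S (k + 2))
        (fun x => hex k _ ((S (k + 1)).sub_mem (hfS k x) (hHS _)) (by simp [hf, hH]))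
      refine ⟨l, fun x => ?_, hlS, fun x => ?_⟩
      · rw [hl]; simp
      · rw [hl]; simp [hM]
  exact ⟨H, hH⟩

end Comparison

/-! ### Exactness of the bar resolution -/

section BarExact

open Finset

variable {G : Type} [Group G]

lemma barSymbol_coe {k : ℕ} (h : Fin k → {x : G // x ≠ 1}) :
    barSymbol G (fun i => (h i : G)) = Finsupp.single h 1 := by
  rw [barSymbol, dif_pos fun i => (h i).2]

lemma barSymbol_eq_zero {k : ℕ} {h : Fin k → G} (i : Fin k) (hi : h i = 1) :
    barSymbol G h = 0 := by
  rw [barSymbol, dif_neg fun H => H i hi]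

lemma barBoundary_symbol {k : ℕ} {h : Fin (k + 1) → G} (hh : ∀ i, h i ≠ 1) :
    barBoundary G k (barSymbol G h) =
      MonoidAlgebra.single (h 0) (1 : ℤ) • barSymbol G (fun i : Fin k => h i.succ) +
        ∑ j : Fin (k + 1), (-1 : ℤ) ^ ((j : ℕ) + 1) •
          barSymbol G (Fin.contractNth j (fun x y : G => x * y) h) := by
  have : barSymbol G h = Finsupp.single (fun i => (⟨h i, hh i⟩ : {x : G // x ≠ 1})) 1 :=
    barSymbol_coe (fun i => (⟨h i, hh i⟩ : {x : G // x ≠ 1}))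
  rw [this, barBoundary, Finsupp.linearCombination_single, one_smul]
  rfl

/-- The contracting homotopy `x[h_1, …, h_k] ↦ [x, h_1, …, h_k]` of the bar resolution. -/
def barS (k : ℕ) : Bar G k →ₗ[ℤ] Bar G (k + 1) :=
  Finsupp.lsum ℤ fun h : Fin k → {x : G // x ≠ 1} =>
    Finsupp.linearCombination ℤ (fun x : G =>
      barSymbol G (Fin.cons x (fun i => (h i : G)) : Fin (k + 1) → G)) ∘ₗ
      (MonoidAlgebra.coeffLinearEquiv ℤ : MonoidAlgebra ℤ G ≃ₗ[ℤ] (G →₀ ℤ)).toLinearMap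

/-- Holds for degenerate symbols too: if some `h i = 1`, both sides are zero. -/
lemma barS_symbol {k : ℕ} (x : G) (h : Fin k → G) :
    barS k (MonoidAlgebra.single x (1 : ℤ) • barSymbol G h) =
      barSymbol G (Fin.cons x h : Fin (k + 1) → G) := by
  by_cases hh : ∀ i, h i ≠ 1
  · have : barSymbol G h = Finsupp.single (fun i => (⟨h i, hh i⟩ : {x : G // x ≠ 1})) 1 :=
      barSymbol_coe (fun i => (⟨h i, hh i⟩ : {x : G // x ≠ 1}))
    rw [this, Finsupp.smul_single, smul_eq_mul, mul_one]
    simp [barS]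
  · push Not at hh
    obtain ⟨i, hi⟩ := hh
    rw [barSymbol_eq_zero i hi, smul_zero, map_zero, barSymbol_eq_zero i.succ (by simpa using hi)]

lemma Bar.hom_ext {k : ℕ} {M : Type*} [AddCommGroup M] {f f' : Bar G k →ₗ[ℤ] M}
    (h : ∀ (x : G) (h : Fin k → G), (∀ i, h i ≠ 1) →
      f (MonoidAlgebra.single x (1 : ℤ) • barSymbol G h) =
        f' (MonoidAlgebra.single x (1 : ℤ) • barSymbol G h)) : f = f' := by
  refine Finsupp.lhom_ext' fun b => MonoidAlgebra.lhom_ext' fun x => LinearMap.ext_ring ?_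
  have := h x (fun i => (b i : G)) fun i => (b i).2
  rw [barSymbol_coe, Finsupp.smul_single, smul_eq_mul, mul_one] at this
  simpa using this

lemma contractNth_zero_cons {k : ℕ} (x : G) (h : Fin (k + 1) → G) :
    Fin.contractNth 0 (fun x y : G => x * y) (Fin.cons x h : Fin (k + 2) → G) =
      (Fin.cons (x * h 0) (fun i => h i.succ) : Fin (k + 1) → G) := by
  funext i
  refine Fin.cases ?_ (fun i => ?_) i
  · simp [Fin.contractNth]
  · simp [Fin.contractNth]

lemma contractNth_succ_cons {k : ℕ} (x : G) (h : Fin (k + 1) → G) (j : Fin (k + 1)) :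
    Fin.contractNth j.succ (fun x y : G => x * y) (Fin.cons x h : Fin (k + 2) → G) =
      (Fin.cons x (Fin.contractNth j (fun x y : G => x * y) h) : Fin (k + 1) → G) := by
  funext i
  refine Fin.cases ?_ (fun i => ?_) i
  · simp [Fin.contractNth]
  · simp [Fin.contractNth]

lemma bar_homotopy (k : ℕ) (b : Bar G (k + 1)) :
    barBoundary G (k + 1) (barS (k + 1) b) + barS k (barBoundary G k b) = b := by
  have : (barBoundary G (k + 1)).toAddMonoidHom.toIntLinearMap ∘ₗ barS (k + 1) +
      barS k ∘ₗ (barBoundary G k).toAddMonoidHom.toIntLinearMap = LinearMap.id := by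
    refine Bar.hom_ext fun x h hh => ?_
    simp only [LinearMap.add_apply, LinearMap.comp_apply, AddMonoidHom.coe_toIntLinearMap,
      LinearMap.toAddMonoidHom_coe, LinearMap.id_apply]
    rw [barS_symbol, map_smul, barBoundary_symbol hh, smul_add, map_add, smul_smul,
      MonoidAlgebra.single_mul_single, one_mul, barS_symbol, smul_sum, map_sum]
    have e : ∀ j : Fin (k + 1), barS k (MonoidAlgebra.single x (1 : ℤ) • (-1 : ℤ) ^ ((j : ℕ) + 1) •
        barSymbol G (Fin.contractNth j (fun x y : G => x * y) h)) = (-1 : ℤ) ^ ((j : ℕ) + 1) •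
        barSymbol G (Fin.cons x (Fin.contractNth j (fun x y : G => x * y) h) : Fin (k + 1) → G) := by
      intro j
      rw [smul_comm, map_smul, barS_symbol]
    rw [sum_congr rfl fun j _ => e j]
    -- For `x = 1` the symbols beginning with `x` vanish, and the first term of the boundary alone
    -- reproduces `[h]`. Otherwise the contraction at `0` cancels against the image of `h_1[h_2,
    -- …]`.
    by_cases hx : x = 1
    · subst hx
      rw [barSymbol_eq_zero 0 rfl, map_zero, sum_eq_zero fun j _ => by
        rw [barSymbol_eq_zero 0 rfl, smul_zero], one_mul, zero_add, add_zero,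
        ← MonoidAlgebra.one_def, one_smul]
      congr 1
      exact Fin.cons_self_tail h
    · have hh' : ∀ i, (Fin.cons x h : Fin (k + 2) → G) i ≠ 1 := Fin.cases hx hh
      rw [barBoundary_symbol hh', Fin.sum_univ_succ, contractNth_zero_cons]
      simp only [contractNth_succ_cons, Fin.cons_zero, Fin.cons_succ, Fin.val_succ, Fin.val_zero]
      simp only [pow_succ _ (_ + 1), zero_add, pow_one, mul_neg, mul_one, neg_smul, one_smul,
        sum_neg_distrib]
      abel
  exact LinearMap.congr_fun this b

/-- The symbol `[]`. -/
abbrev barNil : Bar G 0 := barSymbol G Fin.elim0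

lemma bar_homotopy_zero (x : G) :
    barBoundary G 0 (barS 0 (MonoidAlgebra.single x (1 : ℤ) • barNil)) =
      MonoidAlgebra.single x (1 : ℤ) • barNil - barNil := by
  rw [barS_symbol]
  have e : ∀ h : Fin 0 → G, barSymbol G h = barNil := fun h => by
    rw [Subsingleton.elim h Fin.elim0]
  by_cases hx : x = 1
  · subst hx
    rw [barSymbol_eq_zero 0 rfl, map_zero, ← MonoidAlgebra.one_def, one_smul, sub_self]
  · rw [barBoundary_symbol (Fin.cases hx fun i => i.elim0), e, Fin.sum_univ_one, e]
    simp [sub_eq_add_neg]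

lemma barBoundary_barS_barBoundary (b : Bar G 1) :
    barBoundary G 0 (barS 0 (barBoundary G 0 b)) = barBoundary G 0 b := by
  have : (barBoundary G 0).toAddMonoidHom.toIntLinearMap ∘ₗ barS 0 ∘ₗ
      (barBoundary G 0).toAddMonoidHom.toIntLinearMap =
        (barBoundary G 0).toAddMonoidHom.toIntLinearMap := by
    refine Bar.hom_ext fun x h hh => ?_
    simp only [LinearMap.comp_apply, AddMonoidHom.coe_toIntLinearMap,
      LinearMap.toAddMonoidHom_coe]
    have e : ∀ h : Fin 0 → G, barSymbol G h = barNil := fun h => by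
      rw [Subsingleton.elim h Fin.elim0]
    rw [map_smul, barBoundary_symbol hh, e, Fin.sum_univ_one, e, smul_add, smul_smul,
      MonoidAlgebra.single_mul_single, one_mul]
    simp only [Fin.val_zero, zero_add, pow_one, neg_smul, one_smul, smul_neg, map_neg, map_add,
      bar_homotopy_zero]
    abel
  exact LinearMap.congr_fun this b

/-- No simplicial identities are needed: the homotopy formula gives `∂∂S y = ∂y - ∂S∂y`, which
vanishes by the formula one degree lower together with the induction hypothesis, or in the lowest
degree by `barBoundary_barS_barBoundary`. Every basis symbol has the form `S y`. -/
lemma barBoundary_barBoundary (k : ℕ) (b : Bar G (k + 2)) :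
    barBoundary G k (barBoundary G (k + 1) b) = 0 := by
  induction k with
  | zero =>
    have hS : ∀ y : Bar G 1, barBoundary G 0 (barBoundary G 1 (barS 1 y)) = 0 := fun y => by
      rw [eq_sub_of_add_eq (bar_homotopy 0 y), map_sub, barBoundary_barS_barBoundary, sub_self]
    refine LinearMap.congr_fun (f := barBoundary G 0 ∘ₗ barBoundary G 1) (g := 0) ?_ b
    refine Finsupp.lhom_ext' fun h => LinearMap.ext_ring ?_
    -- The symbol `[h_0, h_1]` is the image under `barS` of `h_0[h_1]`.
    have := hS (MonoidAlgebra.single (h 0 : G) (1 : ℤ) • barSymbol G fun i : Fin 1 => (h i.succ : G))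
    rw [barS_symbol] at this
    have e : (fun i => (h i : G)) = Fin.cons (h 0 : G) fun i => (h i.succ : G) :=
      (Fin.cons_self_tail _).symm
    rw [LinearMap.comp_apply, Finsupp.lsingle_apply, ← barSymbol_coe, e, LinearMap.comp_apply, this,
      LinearMap.zero_comp, LinearMap.zero_apply]
  | succ k ih =>
    have hS : ∀ y : Bar G (k + 2),
        barBoundary G (k + 1) (barBoundary G (k + 2) (barS (k + 2) y)) = 0 := fun y => by
      rw [eq_sub_of_add_eq (bar_homotopy (k + 1) y), map_sub,
        eq_sub_of_add_eq (bar_homotopy k (barBoundary G (k + 1) y)), ih, map_zero, sub_zero,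
        sub_self]
    refine LinearMap.congr_fun (f := barBoundary G (k + 1) ∘ₗ barBoundary G (k + 2)) (g := 0) ?_ b
    refine Finsupp.lhom_ext' fun h => LinearMap.ext_ring ?_
    have := hS (MonoidAlgebra.single (h 0 : G) (1 : ℤ) •
      barSymbol G fun i : Fin (k + 2) => (h i.succ : G))
    rw [barS_symbol] at this
    have e : (fun i => (h i : G)) = Fin.cons (h 0 : G) fun i => (h i.succ : G) :=
      (Fin.cons_self_tail _).symm
    rw [LinearMap.comp_apply, Finsupp.lsingle_apply, ← barSymbol_coe, e, LinearMap.comp_apply, this,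
      LinearMap.zero_comp, LinearMap.zero_apply]

lemma bar_exact (k : ℕ) (y : Bar G (k + 1)) (hy : barBoundary G k y = 0) :
    ∃ z, barBoundary G (k + 1) z = y :=
  ⟨barS (k + 1) y, by simpa [hy] using bar_homotopy k y⟩

end BarExact

/-! ### The tensor product as a complex of free modules -/

section KoszulModule

open Finset Function

variable {n : ℕ} {C : Fin n → Type} [∀ r, CommGroup (C r)]

variable (C) in
/-- The tensor product of the periodic resolutions, as a free module over the group ring. -/
abbrev Kos : Type := (Fin n → ℕ) →₀ MonoidAlgebra ℤ (∀ r, C r)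

/-- Pairs of functions as functions to pairs. -/
def pairEquiv : (Fin n → ℕ) × (∀ r, C r) ≃ ∀ r, ℕ × C r where
  toFun p r := (p.1 r, p.2 r)
  invFun y := (fun r => (y r).1, fun r => (y r).2)
  left_inv _ := rfl
  right_inv _ := rfl

/-- The basis of pairs of a multidegree and a group element. -/
def tensEquiv : Kos C ≃ₗ[ℤ] Tens C :=
  Finsupp.mapRange.linearEquiv (MonoidAlgebra.coeffLinearEquiv ℤ) ≪≫ₗ
    (Finsupp.curryLinearEquiv ℤ).symm ≪≫ₗ Finsupp.domLCongr pairEquiv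

lemma tensEquiv_single (lam : Fin n → ℕ) (x : ∀ r, C r) :
    tensEquiv (Finsupp.single lam (MonoidAlgebra.single x (1 : ℤ))) =
      Finsupp.single (fun r => (lam r, x r)) 1 := by
  have e₁ : MonoidAlgebra.coeffLinearEquiv ℤ (MonoidAlgebra.single x (1 : ℤ)) =
      Finsupp.single x 1 := rfl
  have e₂ : (Finsupp.curryLinearEquiv ℤ).symm (Finsupp.single lam (Finsupp.single x (1 : ℤ))) =
      Finsupp.single (lam, x) 1 := Finsupp.uncurry_single ..
  rw [tensEquiv, LinearEquiv.trans_apply, LinearEquiv.trans_apply,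
    Finsupp.mapRange.linearEquiv_apply, Finsupp.mapRange_single, e₁, e₂]
  simp [pairEquiv]

lemma Kos.hom_ext {M : Type*} [AddCommGroup M] {f f' : Kos C →ₗ[ℤ] M}
    (h : ∀ lam x, f (Finsupp.single lam (MonoidAlgebra.single x (1 : ℤ))) =
      f' (Finsupp.single lam (MonoidAlgebra.single x (1 : ℤ)))) : f = f' := by
  refine Finsupp.lhom_ext' fun b => MonoidAlgebra.lhom_ext' fun x => LinearMap.ext_ring ?_
  exact h b x

lemma tensEquiv_smul (x : ∀ r, C r) (v : Kos C) :
    tensEquiv (MonoidAlgebra.single x (1 : ℤ) • v) = (tensEquiv v).mapDomain (translate x) := by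
  have : tensEquiv.toLinearMap ∘ₗ MonoidAlgebra.GroupSMul.linearMap ℤ (Kos C) x =
      Finsupp.lmapDomain ℤ ℤ (translate x) ∘ₗ tensEquiv.toLinearMap := by
    refine Kos.hom_ext fun lam x' => ?_
    simp only [LinearMap.comp_apply, MonoidAlgebra.GroupSMul.linearMap_apply, Finsupp.smul_single,
      smul_eq_mul, MonoidAlgebra.single_mul_single, one_mul, LinearEquiv.coe_coe, tensEquiv_single,
      Finsupp.lmapDomain_apply, Finsupp.mapDomain_single]
    rfl
  exact LinearMap.congr_fun this v

variable (g : ∀ r, C r)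

/-- The boundary. -/
def kosD : Kos C →ₗ[MonoidAlgebra ℤ (∀ r, C r)] Kos C :=
  MonoidAlgebra.equivariantOfLinearOfComm
    (tensEquiv.symm.toLinearMap ∘ₗ tensD g ∘ₗ tensEquiv.toLinearMap) fun x v => by
      simp only [LinearMap.comp_apply, LinearEquiv.coe_coe]
      rw [LinearEquiv.symm_apply_eq, tensEquiv_smul, tensEquiv_smul, tensD_translate,
        LinearEquiv.apply_symm_apply]

lemma tensEquiv_kosD (v : Kos C) : tensEquiv (kosD g v) = tensD g (tensEquiv v) := by
  simp [kosD]

/-- The contracting homotopy. -/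
def kosS : Kos C →ₗ[ℤ] Kos C :=
  tensEquiv.symm.toLinearMap ∘ₗ tensS g ∘ₗ tensEquiv.toLinearMap

lemma tensEquiv_kosS (v : Kos C) : tensEquiv (kosS g v) = tensS g (tensEquiv v) := by
  simp [kosS]

variable (C) in
/-- The augmentation. -/
def kosP : Kos C →ₗ[ℤ] Kos C :=
  tensEquiv.symm.toLinearMap ∘ₗ tailProj C 0 ∘ₗ tensEquiv.toLinearMap

lemma tensEquiv_kosP (v : Kos C) : tensEquiv (kosP C v) = tailProj C 0 (tensEquiv v) := by
  simp [kosP]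

lemma kosP_single (lam : Fin n → ℕ) (x : ∀ r, C r) :
    kosP C (Finsupp.single lam (MonoidAlgebra.single x (1 : ℤ))) =
      if lam = 0 then Finsupp.single 0 1 else 0 := by
  apply tensEquiv.injective
  rw [tensEquiv_kosP, tensEquiv_single, tailProj_single]
  by_cases h : lam = 0
  · subst h
    simp only [Nat.zero_le, Pi.zero_apply, implies_true, if_true]
    rw [MonoidAlgebra.one_def, tensEquiv_single]
    rfl
  · rw [if_neg h, map_zero, if_neg]
    exact fun h' => h (funext fun s => h' s (Nat.zero_le _))

lemma kosP_smul (x : ∀ r, C r) (v : Kos C) :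
    kosP C (MonoidAlgebra.single x (1 : ℤ) • v) = kosP C v := by
  have : kosP C ∘ₗ MonoidAlgebra.GroupSMul.linearMap ℤ (Kos C) x = kosP C := by
    refine Kos.hom_ext fun lam x' => ?_
    rw [LinearMap.comp_apply, MonoidAlgebra.GroupSMul.linearMap_apply, Finsupp.smul_single,
      smul_eq_mul, MonoidAlgebra.single_mul_single, one_mul, kosP_single, kosP_single]
  exact LinearMap.congr_fun this v

variable (C) in
/-- The augmentation ideal of the complex. -/
def kosKer : Submodule (MonoidAlgebra ℤ (∀ r, C r)) (Kos C) where
  carrier := {v | kosP C v = 0}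
  zero_mem' := map_zero _
  add_mem' {v v'} (hv : kosP C v = 0) (hv' : kosP C v' = 0) := by
    rw [Set.mem_ofPred_eq, map_add, hv, hv', add_zero]
  smul_mem' c v (hv : kosP C v = 0) := by
    rw [Set.mem_ofPred_eq]
    induction c using MonoidAlgebra.induction_linear with
    | zero => rw [zero_smul, map_zero]
    | add c c' hc hc' => rw [add_smul, map_add, hc, hc', add_zero]
    | single x z =>
      have : MonoidAlgebra.single x z = z • MonoidAlgebra.single x (1 : ℤ) := by simp
      rw [this, smul_assoc, map_smul, kosP_smul, hv, smul_zero]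

variable (C) in
/-- The projection to the total degree `k`. -/
def kosProj (k : ℕ) : Kos C →ₗ[MonoidAlgebra ℤ (∀ r, C r)] Kos C :=
  Finsupp.linearCombination _ fun lam => if ∑ r, lam r = k then Finsupp.single lam 1 else 0

lemma kosProj_single (k : ℕ) (lam : Fin n → ℕ) (c : MonoidAlgebra ℤ (∀ r, C r)) :
    kosProj C k (Finsupp.single lam c) =
      if ∑ r, lam r = k then Finsupp.single lam c else 0 := by
  rw [kosProj, Finsupp.linearCombination_single]
  split_ifs <;> simp

lemma tensEquiv_kosProj (k : ℕ) (v : Kos C) :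
    tensEquiv (kosProj C k v) = degProj C k (tensEquiv v) := by
  have : tensEquiv.toLinearMap ∘ₗ (kosProj C k).toAddMonoidHom.toIntLinearMap =
      degProj C k ∘ₗ tensEquiv.toLinearMap := by
    refine Kos.hom_ext fun lam x => ?_
    simp only [LinearMap.comp_apply, AddMonoidHom.coe_toIntLinearMap,
      LinearMap.toAddMonoidHom_coe, LinearEquiv.coe_coe, kosProj_single, tensEquiv_single,
      degProj_single]
    rw [apply_ite tensEquiv, map_zero, tensEquiv_single]
    rfl
  exact LinearMap.congr_fun this v

lemma kosProj_kosProj (k : ℕ) (v : Kos C) : kosProj C k (kosProj C k v) = kosProj C k v := by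
  refine LinearMap.congr_fun (f := kosProj C k ∘ₗ kosProj C k) ?_ v
  refine Finsupp.lhom_ext' fun lam => LinearMap.ext_ring ?_
  simp only [LinearMap.comp_apply, Finsupp.lsingle_apply, kosProj_single]
  split_ifs with h
  · rw [kosProj_single, if_pos h]
  · rw [map_zero]

lemma kosD_kosProj (k : ℕ) (v : Kos C) :
    kosD g (kosProj C (k + 1) v) = kosProj C k (kosD g v) := by
  apply tensEquiv.injective
  rw [tensEquiv_kosD, tensEquiv_kosProj, tensEquiv_kosProj, tensEquiv_kosD]
  exact (LinearMap.congr_fun (degProj_tensD g k) (tensEquiv v)).symm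

lemma kosProj_succ_mem (k : ℕ) (v : Kos C) : kosProj C (k + 1) v ∈ kosKer C := by
  rw [kosProj, Finsupp.linearCombination_apply]
  refine Submodule.sum_mem _ fun lam _ => Submodule.smul_mem _ _ ?_
  split_ifs with h
  · change kosP C _ = 0
    rw [MonoidAlgebra.one_def, kosP_single, if_neg]
    rintro rfl
    simp at h
  · exact Submodule.zero_mem _

lemma kosD_single_zero (c : MonoidAlgebra ℤ (∀ r, C r)) : kosD g (Finsupp.single 0 c) = 0 := by
  have : kosD g (Finsupp.single 0 1) = 0 := by
    apply tensEquiv.injective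
    rw [tensEquiv_kosD, MonoidAlgebra.one_def, tensEquiv_single, map_zero, tensD,
      LinearMap.sum_apply]
    refine sum_eq_zero fun r _ => ?_
    rw [tensD₁, Module.End.mul_apply, tailSign_single, map_smul, slot_single]
    simp [cycD]
  rw [← mul_one c, ← smul_eq_mul, ← Finsupp.smul_single, map_smul, this, smul_zero]

lemma kosS_single_zero : kosS g (Finsupp.single 0 1) = 0 := by
  apply tensEquiv.injective
  rw [tensEquiv_kosS, MonoidAlgebra.one_def, tensEquiv_single, map_zero, tensS_single]
  refine sum_eq_zero fun r _ => ?_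
  split_ifs
  · rw [slot_single]
    simp [cycS, resetTail, dlog_one]
  · rfl

variable {g} (hg : ∀ r, IsGen (g r))
include hg

lemma kosD_kosD (v : Kos C) : kosD g (kosD g v) = 0 := by
  apply tensEquiv.injective
  rw [tensEquiv_kosD, tensEquiv_kosD, map_zero]
  exact LinearMap.congr_fun (tensD_mul_tensD hg) (tensEquiv v)

lemma kosS_kosS (v : Kos C) : kosS g (kosS g v) = 0 := by
  apply tensEquiv.injective
  rw [tensEquiv_kosS, tensEquiv_kosS, map_zero]
  exact LinearMap.congr_fun (tensS_mul_tensS hg) (tensEquiv v)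

lemma kosP_kosS (v : Kos C) : kosP C (kosS g v) = 0 := by
  apply tensEquiv.injective
  rw [tensEquiv_kosP, tensEquiv_kosS, map_zero]
  exact LinearMap.congr_fun (tailProj_zero_mul_tensS hg) (tensEquiv v)

lemma kosP_kosD (v : Kos C) : kosP C (kosD g v) = 0 := by
  apply tensEquiv.injective
  rw [tensEquiv_kosP, tensEquiv_kosD, map_zero]
  exact LinearMap.congr_fun (tailProj_zero_mul_tensD hg) (tensEquiv v)

lemma kos_homotopy (v : Kos C) : kosD g (kosS g v) + kosS g (kosD g v) = v - kosP C v := by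
  apply tensEquiv.injective
  rw [map_add, map_sub, tensEquiv_kosP, tensEquiv_kosD, tensEquiv_kosS, tensEquiv_kosS,
    tensEquiv_kosD]
  exact LinearMap.congr_fun (tens_homotopy hg) (tensEquiv v)

lemma kos_exact {v : Kos C} (hv : v ∈ kosKer C) (hd : kosD g v = 0) :
    ∃ z ∈ kosKer C, kosD g z = v := by
  refine ⟨kosS g v, kosP_kosS hg v, ?_⟩
  have := kos_homotopy hg v
  rwa [hd, map_zero, add_zero, show kosP C v = 0 from hv, sub_zero] at this

end KoszulModule

/-! ### The comparison with the bar resolution -/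

section Compare

open Finset

variable {n : ℕ} {C : Fin n → Type} [∀ r, CommGroup (C r)] (g : ∀ r, C r)

/-- The comparison map from the bar resolution, built from the contracting homotopy. -/
def barToKos : ∀ k : ℕ, Bar (∀ r, C r) k →ₗ[MonoidAlgebra ℤ (∀ r, C r)] Kos C
  | 0 => Finsupp.linearCombination _ fun _ => Finsupp.single 0 1
  | k + 1 => Finsupp.linearCombination _ fun h =>
      kosS g (barToKos k (barBoundary (∀ r, C r) k (Finsupp.single h 1)))

lemma barToKos_zero_symbol (h : Fin 0 → ∀ r, C r) :
    barToKos g 0 (barSymbol _ h) = Finsupp.single 0 1 := by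
  rw [barSymbol, dif_pos fun i => i.elim0, barToKos, Finsupp.linearCombination_single, one_smul]

variable {g} (hg : ∀ r, IsGen (g r))
include hg

/-- Write `D S = 1 - P - S D` on `f ∂[h]`: the augmentation term vanishes, and `D f ∂ = f ∂ ∂ = 0`
by the previous degree. -/
lemma barToKos_boundary (k : ℕ) (b : Bar (∀ r, C r) (k + 1)) :
    kosD g (barToKos g (k + 1) b) = barToKos g k (barBoundary _ k b) := by
  refine LinearMap.congr_fun (f := kosD g ∘ₗ barToKos g (k + 1))
    (g := barToKos g k ∘ₗ barBoundary _ k) ?_ b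
  refine Finsupp.lhom_ext' fun h => LinearMap.ext_ring ?_
  simp only [LinearMap.comp_apply, Finsupp.lsingle_apply]
  rw [barToKos, Finsupp.linearCombination_single, one_smul, eq_sub_of_add_eq (kos_homotopy hg _)]
  cases k with
  | zero =>
    have h1 : ∀ x, kosD g (barToKos g 0 x) = 0 := fun x => by
      refine LinearMap.congr_fun (f := kosD g ∘ₗ barToKos g 0) (g := 0) ?_ x
      refine Finsupp.lhom_ext' fun h => LinearMap.ext_ring ?_
      simp [barToKos, kosD_single_zero]
    rw [h1, map_zero, sub_zero, ← barSymbol_coe, barBoundary_symbol fun i => (h i).2, map_add,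
      map_smul, Fin.sum_univ_one, map_zsmul, barToKos_zero_symbol, barToKos_zero_symbol,
      Finsupp.smul_single, smul_eq_mul, mul_one]
    have : kosP C (Finsupp.single (0 : Fin n → ℕ)
        (MonoidAlgebra.single (h 0 : ∀ r, C r) (1 : ℤ)) +
        (-1 : ℤ) ^ (((0 : Fin 1) : ℕ) + 1) • Finsupp.single 0 1) = 0 := by
      rw [MonoidAlgebra.one_def, map_add, map_smul, kosP_single, kosP_single]
      simp
    rw [this, sub_zero]
  | succ k =>
    have h1 : ∀ x, kosP C (barToKos g (k + 1) x) = 0 := fun x => by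
      change barToKos g (k + 1) x ∈ kosKer C
      rw [barToKos, Finsupp.linearCombination_apply]
      exact Submodule.sum_mem _ fun h _ => Submodule.smul_mem _ _ (kosP_kosS hg _)
    rw [h1, sub_zero, barToKos_boundary k, barBoundary_barBoundary, map_zero, map_zero, sub_zero]

lemma barToKos_succ_mem (k : ℕ) (b : Bar (∀ r, C r) (k + 1)) :
    barToKos g (k + 1) b ∈ kosKer C := by
  rw [barToKos, Finsupp.linearCombination_apply]
  exact Submodule.sum_mem _ fun h _ => Submodule.smul_mem _ _ (kosP_kosS hg _)

lemma kosS_barToKos_symbol (k : ℕ) (h : Fin k → ∀ r, C r) :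
    kosS g (barToKos g k (barSymbol _ h)) = 0 := by
  cases k with
  | zero => rw [barToKos_zero_symbol, kosS_single_zero]
  | succ k =>
    rw [barSymbol]
    split_ifs
    · rw [barToKos, Finsupp.linearCombination_single, one_smul, kosS_kosS hg]
    · rw [map_zero, map_zero]

/-- All terms of `∂[h]` except `h_1[h_2, …]` are integer multiples of symbols, whose images lie in
the range of `S` or are the base point; both are killed by `S`. The first term survives only because
`S` is not equivariant. -/
lemma barToKos_symbol (k : ℕ) (h : Fin (k + 1) → ∀ r, C r) :
    barToKos g (k + 1) (barSymbol _ h) = kosS g (MonoidAlgebra.single (h 0) (1 : ℤ) •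
      barToKos g k (barSymbol _ fun i : Fin k => h i.succ)) := by
  by_cases hh : ∀ i, h i ≠ 1
  · have e : barSymbol _ h =
        Finsupp.single (fun i => (⟨h i, hh i⟩ : {x : ∀ r, C r // x ≠ 1})) 1 :=
      barSymbol_coe (fun i => (⟨h i, hh i⟩ : {x : ∀ r, C r // x ≠ 1}))
    rw [e, barToKos, Finsupp.linearCombination_single, one_smul, ← e, barBoundary_symbol hh,
      map_add, map_add, map_smul, map_sum, map_sum, sum_eq_zero, add_zero]
    intro j _
    rw [map_zsmul, map_zsmul, kosS_barToKos_symbol hg, smul_zero]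
  · push Not at hh
    obtain ⟨i, hi⟩ := hh
    rw [barSymbol_eq_zero i hi, map_zero]
    revert hi
    refine Fin.cases (fun hi => ?_) (fun i hi => ?_) i
    · rw [hi, ← MonoidAlgebra.one_def, one_smul, kosS_barToKos_symbol hg]
    · rw [barSymbol_eq_zero i hi, map_zero, smul_zero, map_zero]

variable (C) in
/-- The degree zero part of a comparison map to the bar resolution. -/
def kosToBarZero : Kos C →ₗ[MonoidAlgebra ℤ (∀ r, C r)] Bar (∀ r, C r) 0 :=
  Finsupp.linearCombination _ fun lam => if lam = 0 then barNil else 0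

lemma boundary_barS_kosToBarZero (v : Kos C) :
    barBoundary _ 0 (barS 0 (kosToBarZero C v)) = kosToBarZero C v - kosToBarZero C (kosP C v) := by
  have : (barBoundary _ 0).toAddMonoidHom.toIntLinearMap ∘ₗ barS 0 ∘ₗ
      (kosToBarZero C).toAddMonoidHom.toIntLinearMap =
      (kosToBarZero C).toAddMonoidHom.toIntLinearMap -
        (kosToBarZero C).toAddMonoidHom.toIntLinearMap ∘ₗ kosP C := by
    refine Kos.hom_ext fun lam x => ?_
    simp only [LinearMap.sub_apply, LinearMap.comp_apply, AddMonoidHom.coe_toIntLinearMap,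
      LinearMap.toAddMonoidHom_coe, kosP_single]
    by_cases h : lam = 0
    · subst h
      simp only [kosToBarZero, Finsupp.linearCombination_single, if_true, bar_homotopy_zero,
        one_smul]
    · simp [kosToBarZero, h]
  exact LinearMap.congr_fun this v

lemma exists_kosToBar : ∃ ψ : ∀ k, Kos C →ₗ[MonoidAlgebra ℤ (∀ r, C r)] Bar (∀ r, C r) k,
    ψ 0 = kosToBarZero C ∧ (∀ k v, barBoundary _ k (ψ (k + 1) v) = ψ k (kosD g v)) ∧
      ∀ k v, ψ k (kosProj C k v) = ψ k v := by
  obtain ⟨ψ, h₀, hψ⟩ := exists_chainMap (X := fun _ => Fin n → ℕ) (fun _ => kosD g)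
    (barBoundary (∀ r, C r)) (fun _ => kosD_kosD hg) bar_exact (kosToBarZero C) fun v =>
      ⟨_, (boundary_barS_kosToBarZero hg (kosD g v)).trans
        (by rw [kosP_kosD hg, map_zero, sub_zero])⟩
  -- The lift is defined on all of `Kos` in every degree; composing with the projection to total
  -- degree `k` keeps it a chain map and makes it see degree `k` only.
  refine ⟨fun k => ψ k ∘ₗ kosProj C k, ?_, fun k v => ?_, fun k v => ?_⟩
  · beta_reduce
    rw [h₀]
    refine Finsupp.lhom_ext' fun lam => LinearMap.ext_ring ?_
    simp only [LinearMap.comp_apply, Finsupp.lsingle_apply, kosProj_single]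
    split_ifs with h
    · rfl
    · rw [map_zero, kosToBarZero, Finsupp.linearCombination_single, if_neg, smul_zero]
      rintro rfl
      simp at h
  · rw [LinearMap.comp_apply, hψ, kosD_kosProj]
    rfl
  · rw [LinearMap.comp_apply, LinearMap.comp_apply, kosProj_kosProj]

variable {A : Type*} [AddCommGroup A] [Module (MonoidAlgebra ℤ (∀ r, C r)) A]

/-- The comparison map is injective and surjective on cohomology in positive degrees. -/
lemma exists_comparison (k : ℕ) :
    (∀ z : Bar (∀ r, C r) (k + 1) →ₗ[MonoidAlgebra ℤ (∀ r, C r)] A,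
      z ∘ₗ barBoundary _ (k + 1) = 0 → ∃ F : Kos C →ₗ[MonoidAlgebra ℤ (∀ r, C r)] A,
        F ∘ₗ kosD g = 0 ∧ F ∘ₗ kosProj C (k + 1) = F ∧
          ∃ y, z - F ∘ₗ barToKos g (k + 1) = y ∘ₗ barBoundary _ k) ∧
    (∀ F : Kos C →ₗ[MonoidAlgebra ℤ (∀ r, C r)] A, F ∘ₗ kosD g = 0 →
      (∃ y, F ∘ₗ barToKos g (k + 1) = y ∘ₗ barBoundary _ k) →
        ∃ F', F ∘ₗ kosProj C (k + 1) = F' ∘ₗ kosD g) := by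
  obtain ⟨ψ, hψ₀, hψ, hψP⟩ := exists_kosToBar hg
  -- `H` contracts `ψ f - 1` on the bar resolution, where `f` is the comparison map.
  obtain ⟨H, hH⟩ := exists_nullHomotopy (barBoundary (∀ r, C r)) (barBoundary (∀ r, C r))
    barBoundary_barBoundary (fun _ => ⊤)
    (fun k y _ hy => (bar_exact k y hy).imp fun _ hz => ⟨trivial, hz⟩)
    (fun k => ψ k ∘ₗ barToKos g k - LinearMap.id) (fun k b => by
      simp only [LinearMap.sub_apply, LinearMap.comp_apply, LinearMap.id_apply, map_sub, hψ,
        barToKos_boundary hg])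
    (by
      refine Finsupp.lhom_ext' fun h => LinearMap.ext_ring ?_
      rw [hψ₀, LinearMap.comp_apply, Finsupp.lsingle_apply, ← barSymbol_coe, LinearMap.sub_apply,
        LinearMap.comp_apply, barToKos_zero_symbol, kosToBarZero, Finsupp.linearCombination_single,
        if_pos rfl, one_smul, LinearMap.id_apply, LinearMap.zero_comp,
        LinearMap.zero_apply, sub_eq_zero]
      exact congrArg (barSymbol _) (Subsingleton.elim _ _))
    (fun _ _ => trivial)
  -- `H'` contracts `f ψ - kosProj`, the projection standing in for the identity of degree `k`.
  obtain ⟨H', hH'⟩ := exists_nullHomotopy (X := fun _ => Fin n → ℕ) (fun _ => kosD g)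
    (fun _ => kosD g) (fun _ => kosD_kosD hg) (fun _ => kosKer C)
    (fun _ y hy hd => kos_exact hg hy hd) (fun k => barToKos g k ∘ₗ ψ k - kosProj C k)
    (fun k v => by
      simp only [LinearMap.sub_apply, LinearMap.comp_apply, map_sub, hψ,
        barToKos_boundary hg, kosD_kosProj])
    (by
      refine Finsupp.lhom_ext' fun lam => LinearMap.ext_ring ?_
      rw [hψ₀, LinearMap.comp_apply, Finsupp.lsingle_apply, LinearMap.sub_apply,
        LinearMap.comp_apply, kosToBarZero, Finsupp.linearCombination_single, kosProj_single,
        one_smul]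
      by_cases h : lam = 0
      · subst h
        simp [barToKos_zero_symbol]
      · rw [if_neg h, if_neg]
        · simp
        · intro h'
          exact h (funext fun s => (sum_eq_zero_iff.1 h') s (mem_univ s)))
    (fun k v => Submodule.sub_mem _ (barToKos_succ_mem hg k _) (kosProj_succ_mem k v))
  constructor
  · intro z hz
    refine ⟨z ∘ₗ ψ (k + 1), ?_, LinearMap.ext fun v => ?_, -(z ∘ₗ H k), LinearMap.ext fun b => ?_⟩
    · refine LinearMap.ext fun v => ?_
      rw [LinearMap.comp_apply, LinearMap.comp_apply, ← hψ]
      exact LinearMap.congr_fun hz _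
    · simp [hψP]
    · have := congrArg z (hH k b)
      rw [map_add, show z (barBoundary _ (k + 1) _) = 0 from LinearMap.congr_fun hz _, zero_add]
        at this
      simp only [LinearMap.sub_apply, LinearMap.comp_apply, LinearMap.id_apply, map_sub,
        LinearMap.neg_apply] at this ⊢
      rw [← this, neg_sub]
  · rintro F hF ⟨y, hy⟩
    -- From `F kosProj = F f ψ - F (f ψ - kosProj)`: the first part is `y ψ D`, and the second is `F
    -- H' D` because `F D = 0`.
    refine ⟨y ∘ₗ ψ k - F ∘ₗ H' k, LinearMap.ext fun v => ?_⟩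
    have h1 := congrArg F (hH' k v)
    rw [map_add, show F (kosD g _) = 0 from LinearMap.congr_fun hF _, zero_add] at h1
    have h2 := LinearMap.congr_fun hy (ψ (k + 1) v)
    simp only [LinearMap.sub_apply, LinearMap.comp_apply, map_sub, hψ] at h1 h2 ⊢
    rw [← h1, h2, sub_sub_cancel]

end Compare

/-! ### The values of the comparison map -/

section Values

open Finset Function

/-- The contribution of one cyclic factor in degree `len`, with arguments from position `a` on. -/
def cycFactor (M : ℕ) (α : ℕ → ℕ) (a len : ℕ) : ℕ :=
  if Even len then ∏ t ∈ range (len / 2), (α (a + 2 * t) + α (a + 2 * t + 1)) / M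
  else α a * ∏ t ∈ range (len / 2), (α (a + 1 + 2 * t) + α (a + 1 + 2 * t + 1)) / M

lemma cycFactor_zero (M : ℕ) (α : ℕ → ℕ) (a : ℕ) : cycFactor M α a 0 = 1 := by simp [cycFactor]

lemma cycFactor_shift (M : ℕ) (α : ℕ → ℕ) (d a len : ℕ) :
    cycFactor M (fun j => α (j + d)) a len = cycFactor M α (a + d) len := by
  simp only [cycFactor]
  split_ifs
  · refine prod_congr rfl fun t _ => ?_
    congr 3 <;> omega
  · congr 1
    refine prod_congr rfl fun t _ => ?_
    congr 3 <;> omega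

lemma cycFactor_odd (M : ℕ) (α : ℕ → ℕ) (a : ℕ) {len : ℕ} (h : Odd len) :
    cycFactor M α a len = α a * cycFactor M α (a + 1) (len - 1) := by
  obtain ⟨j, rfl⟩ := h
  have h1 : ¬ Even (2 * j + 1) := by simp
  have h2 : (2 * j + 1) / 2 = j := by omega
  simp [cycFactor, h1, h2]

lemma cycFactor_even (M : ℕ) (α : ℕ → ℕ) (a : ℕ) {len : ℕ} (h : Even len) (h0 : len ≠ 0) :
    cycFactor M α a len = (α a + α (a + 1)) / M * cycFactor M α (a + 2) (len - 2) := by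
  obtain ⟨j, rfl⟩ := even_iff_two_dvd.1 h
  obtain ⟨j, rfl⟩ : ∃ i, j = i + 1 := ⟨j - 1, by omega⟩
  have e : 2 * (j + 1) - 2 = 2 * j := by omega
  have e' : ∀ t, a + 2 * (t + 1) = a + 2 + 2 * t := fun t => by omega
  simp only [cycFactor, e, even_two_mul, if_true, Nat.mul_div_cancel_left _ two_pos,
    prod_range_succ', e', mul_zero, add_zero]
  rw [mul_comm]

/-- `eta` multiplies carries from the top argument downwards, while the recursion of the comparison
map produces them from the bottom up; the products are reversals of each other. -/
lemma eta_eq_cycFactor (M : ℕ) (α : ℕ → ℕ) (a : ℕ) {len : ℕ} (h : 1 ≤ len) :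
    eta M α a (a + len - 1) = cycFactor M α a len := by
  have hb : a + len - 1 - a = len - 1 := by omega
  rw [eta, cycFactor, hb]
  rcases Nat.even_or_odd len with he | ho
  · have h1 : Odd (len - 1) := Nat.Even.sub_odd h he odd_one
    rw [if_pos h1, if_pos he, show len - 1 + 1 = len by omega, ← prod_range_reflect]
    refine prod_congr rfl fun t ht => ?_
    have ht := mem_range.1 ht
    obtain ⟨j, rfl⟩ := even_iff_two_dvd.1 he
    rw [Nat.mul_div_cancel_left _ two_pos] at ht ⊢
    rw [add_comm (α (a + 2 * t))]
    congr 3 <;> omega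
  · have h1 : ¬ Odd (len - 1) := by
      rw [Nat.not_odd_iff_even]; exact Nat.Odd.sub_odd ho odd_one
    rw [if_neg h1, if_neg (Nat.not_even_iff_odd.2 ho), mul_comm,
      show len / 2 = (len - 1) / 2 by obtain ⟨j, rfl⟩ := ho; omega, ← prod_range_reflect]
    congr 1
    refine prod_congr rfl fun t ht => ?_
    have ht := mem_range.1 ht
    obtain ⟨j, rfl⟩ := ho
    rw [add_comm (α (a + 1 + 2 * t))]
    congr 3 <;> omega

variable {n : ℕ}

/-- The coefficient of the multidegree `lam` in the image of `[g^{α_1}, …, g^{α_k}]`. -/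
def multiFactor (m : Fin n → ℕ) (α : ℕ → Fin n → ℕ) (lam : Fin n → ℕ) : ℕ :=
  ∏ r, cycFactor (m r) (fun j => α j r) (∑ s ∈ Ioi r, lam s + 1) (lam r)

/-- The last nonzero slot `r` uses the first arguments. Lowering its degree by `d` lowers the
starting positions of all earlier slots by `d`, which the shift of `α` compensates; slots beyond `r`
contribute `1`. -/
lemma multiFactor_top (m : Fin n → ℕ) (α : ℕ → Fin n → ℕ) {lam : Fin n → ℕ} {r : Fin n}
    (h : ∀ s, r < s → lam s = 0) {c d : ℕ} (hd : d ≤ lam r)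
    (hr : cycFactor (m r) (fun j => α j r) 1 (lam r) =
      c * cycFactor (m r) (fun j => α j r) (1 + d) (lam r - d)) :
    multiFactor m α lam =
      c * multiFactor m (fun j => α (j + d)) (update lam r (lam r - d)) := by
  rw [multiFactor, multiFactor, ← mul_prod_erase univ _ (mem_univ r),
    ← mul_prod_erase univ (fun s => cycFactor (m s) (fun j => α (j + d) s) _ _) (mem_univ r),
    ← mul_assoc]
  have h0 : ∑ s ∈ Ioi r, lam s = 0 := sum_eq_zero fun s hs => h s (mem_Ioi.1 hs)
  have h0' : ∑ s ∈ Ioi r, update lam r (lam r - d) s = 0 := sum_eq_zero fun s hs => by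
    rw [update_of_ne (ne_of_gt (mem_Ioi.1 hs)), h s (mem_Ioi.1 hs)]
  rw [h0, h0', zero_add, update_self, cycFactor_shift (m r) (fun j => α j r), hr]
  congr 1
  refine prod_congr rfl fun s hs => ?_
  have hs := ne_of_mem_erase hs
  rw [update_of_ne hs]
  rcases lt_or_gt_of_ne hs with hlt | hlt
  · rw [cycFactor_shift (m s) (fun j => α j s)]
    congr 1
    have hr := mem_Ioi.2 hlt
    have e : ∑ t ∈ (Ioi s).erase r, update lam r (lam r - d) t = ∑ t ∈ (Ioi s).erase r, lam t :=
      sum_congr rfl fun t ht => update_of_ne (ne_of_mem_erase ht) _ _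
    rw [← add_sum_erase _ lam hr, ← add_sum_erase _ (update lam r (lam r - d)) hr, update_self, e]
    omega
  · rw [h s hlt, cycFactor_zero, cycFactor_zero]

lemma dlog_pow_mod {C : Type*} [CommGroup C] {g : C} (hg : 0 < orderOf g) (i : ℕ) :
    dlog g (g ^ i) = i % orderOf g := by
  rw [← pow_mod_orderOf, dlog_pow (Nat.mod_lt _ hg)]

lemma sum_carry {C : Type*} [CommGroup C] {g : C} {i j : ℕ} (hi : i < orderOf g)
    (hj : j < orderOf g) : (∑ t ∈ range j,
      if dlog g (g ^ i * g ^ t) + 1 = orderOf g then (1 : ℤ) else 0) =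
        ((i + j) / orderOf g : ℕ) := by
  have hpos : 0 < orderOf g := by omega
  -- Since `i + t < 2 * orderOf g - 1`, the residue `orderOf g - 1` is reached only without a wrap,
  -- at `t = orderOf g - 1 - i`; this lies below `j` exactly when `i + j` carries.
  have e : ∀ t ∈ range j, (if dlog g (g ^ i * g ^ t) + 1 = orderOf g then (1 : ℤ) else 0) =
      if t = orderOf g - 1 - i then 1 else 0 := by
    intro t ht
    have ht := mem_range.1 ht
    rw [← pow_add, dlog_pow_mod hpos]
    refine if_congr ?_ rfl rfl
    rcases lt_or_ge (i + t) (orderOf g) with h | h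
    · rw [Nat.mod_eq_of_lt h]; omega
    · rw [Nat.mod_eq_sub_mod h, Nat.mod_eq_of_lt (by omega)]; omega
  rw [sum_congr rfl e, sum_ite_eq']
  rcases lt_or_ge (i + j) (orderOf g) with h | h
  · rw [Nat.div_eq_of_lt h, if_neg (by rw [mem_range]; omega), Nat.cast_zero]
  · have : (i + j) / orderOf g = 1 :=
      Nat.div_eq_of_lt_le (by omega) (by omega)
    rw [this, if_pos (by rw [mem_range]; omega), Nat.cast_one]

variable {C : Fin n → Type} [∀ r, CommGroup (C r)]

/-- The sum of the coefficients in multidegree `lam`. -/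
def degCoeff (lam : Fin n → ℕ) : Tens C →ₗ[ℤ] ℤ :=
  Finsupp.linearCombination ℤ fun y => if deg y = lam then 1 else 0

lemma degCoeff_single (lam : Fin n → ℕ) (y : ∀ r, ℕ × C r) :
    degCoeff lam (Finsupp.single y 1) = if deg y = lam then 1 else 0 := by simp [degCoeff]

lemma fiber_one (lam : Fin n → ℕ) (r : Fin n) : fiber (C := C) lam r 1 = degCoeff lam := rfl

lemma exists_top {lam : Fin n → ℕ} (h : lam ≠ 0) :
    ∃ r, lam r ≠ 0 ∧ ∀ s, r < s → lam s = 0 := by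
  have hne : (univ.filter fun r => lam r ≠ 0).Nonempty := by
    obtain ⟨r, hr⟩ := Function.ne_iff.1 h
    exact ⟨r, by simpa using hr⟩
  refine ⟨_, (mem_filter.1 (max'_mem _ hne)).2, fun s hs => ?_⟩
  by_contra h'
  exact absurd (le_max' _ s (mem_filter.2 ⟨mem_univ s, h'⟩)) (not_le.2 hs)

variable {g : ∀ r, C r} (hg : ∀ r, IsGen (g r))
include hg

lemma barToKos_settled (k : ℕ) (h : Fin k → ∀ r, C r) :
    tensEquiv (barToKos g k (barSymbol _ h)) ∈ settled C := by
  cases k with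
  | zero =>
    rw [barToKos_zero_symbol, MonoidAlgebra.one_def, tensEquiv_single]
    exact Finsupp.single_mem_supported ℤ _ fun _ _ _ => rfl
  | succ k =>
    rw [barToKos_symbol hg, tensEquiv_kosS]
    exact tensS_mem_settled g _

lemma fiber_barToKos_succ (k : ℕ) (α : ℕ → Fin n → ℕ) {lam : Fin n → ℕ} {r : Fin n}
    (hr : lam r ≠ 0) (h : ∀ s, r < s → lam s = 0) (τ : C r → ℤ) :
    fiber lam r τ (tensEquiv (barToKos g (k + 1) (barSymbol _
      fun (j : Fin (k + 1)) r => g r ^ α (j + 1) r))) =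
    fiber (lowerAt r lam) r (fun b => if Odd (lam r) then
        ∑ i ∈ range (dlog (g r) (g r ^ α 1 r * b)), τ (g r ^ i) else
        if dlog (g r) (g r ^ α 1 r * b) + 1 = orderOf (g r) then τ 1 else 0)
      (tensEquiv (barToKos g k (barSymbol _ fun (j : Fin k) r => g r ^ α (j + 1 + 1) r))) := by
  rw [barToKos_symbol hg, tensEquiv_kosS, fiber_tensS g hr h, tensEquiv_smul, fiber_translate]
  rfl

/-- Strong induction, peeling arguments off the last nonzero slot `r`. The recursion evaluates a
weight on the image of the remaining arguments, and once the degree at `r` is even that image is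
settled, so the weight is a constant factor. One step suffices if `lam r` is odd, two if it is even.
-/
lemma degCoeff_barToKos (k : ℕ) (α : ℕ → Fin n → ℕ)
    (hα : ∀ j ∈ Icc 1 k, ∀ r, α j r < orderOf (g r)) (lam : Fin n → ℕ) (hlam : ∑ r, lam r = k) :
    degCoeff lam (tensEquiv (barToKos g k (barSymbol _ fun (j : Fin k) r => g r ^ α (j + 1) r))) =
      multiFactor (fun r => orderOf (g r)) α lam := by
  induction k using Nat.strong_induction_on generalizing α lam with
  | _ k ih =>
    by_cases h0 : lam = 0
    · subst h0
      obtain rfl : k = 0 := by simpa using hlam.symm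
      rw [barToKos_zero_symbol, MonoidAlgebra.one_def, tensEquiv_single, degCoeff_single,
        if_pos (by rfl)]
      simp [multiFactor, cycFactor_zero]
    · obtain ⟨r, hr, hs⟩ := exists_top h0
      have hsum := sum_lowerAt hr
      have hs' : ∀ s, r < s → lowerAt r lam s = 0 := fun s h => by
        rw [lowerAt, update_of_ne h.ne', hs s h]
      have hr' : lowerAt r lam r = lam r - 1 := update_self ..
      obtain ⟨k, rfl⟩ : ∃ i, k = i + 1 := ⟨k - 1, by omega⟩
      rw [← fiber_one lam r, fiber_barToKos_succ hg k α hr hs]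
      rcases Nat.even_or_odd (lam r) with he | ho
      · have hr1 : Odd (lowerAt r lam r) := by
          rw [hr']; exact Nat.Even.sub_odd (Nat.one_le_iff_ne_zero.2 hr) he odd_one
        have hr0 : lowerAt r lam r ≠ 0 := fun h => by rw [h] at hr1; simp at hr1
        have hsum' := sum_lowerAt hr0
        obtain ⟨k, rfl⟩ : ∃ i, k = i + 1 := ⟨k - 1, by omega⟩
        have hs'' : ∀ s, r < s → lowerAt r (lowerAt r lam) s = 0 := fun s h => by
          rw [lowerAt, update_of_ne h.ne', hs' s h]
        have hr'' : Even (lowerAt r (lowerAt r lam) r) := by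
          rw [lowerAt, update_self]
          exact Nat.Odd.sub_odd hr1 odd_one
        have h1 := hα 1 (mem_Icc.2 ⟨le_rfl, by omega⟩) r
        have h2 := hα 2 (mem_Icc.2 ⟨by omega, by omega⟩) r
        have h2lam : lowerAt r (lowerAt r lam) = update lam r (lam r - 2) := by
          simp only [lowerAt, update_self, update_idem]
          congr 1
        -- The first step leaves the indicator of the last power of `g r`, translated by `α 1`; the
        -- second sums it over the powers below `α 2`, which counts the carry.
        rw [fiber_barToKos_succ hg k (fun j => α (j + 1)) hr0 hs', fiber_settled hr'' hs'' _
          (barToKos_settled hg _ _), fiber_one, ih k (by omega) (fun j => α (j + 1 + 1))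
          (fun j hj r => hα _ (mem_Icc.2 ⟨by omega, by have := mem_Icc.1 hj; omega⟩) r) _
          (by omega)]
        simp only [if_pos hr1, if_neg (Nat.not_odd_iff_even.2 he), mul_one, Pi.one_apply]
        rw [dlog_pow h2, sum_carry h1 h2, multiFactor_top _ α hs
          (c := (α 1 r + α 2 r) / orderOf (g r)) (d := 2) (by
            have := Nat.one_le_iff_ne_zero.2 hr0
            omega) (cycFactor_even _ _ _ he hr), h2lam, Nat.cast_mul]
      · have hr1 : Even (lowerAt r lam r) := by
          rw [hr']; exact Nat.Odd.sub_odd ho odd_one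
        have h1 := hα 1 (mem_Icc.2 ⟨le_rfl, by omega⟩) r
        rw [fiber_settled hr1 hs' _ (barToKos_settled hg _ _), fiber_one, ih k (by omega)
          (fun j => α (j + 1))
          (fun j hj r => hα _ (mem_Icc.2 ⟨by omega, by have := mem_Icc.1 hj; omega⟩) r) _
          (by omega), multiFactor_top _ α hs (c := α 1 r) (d := 1)
          (Nat.one_le_iff_ne_zero.2 hr) (cycFactor_odd _ _ _ ho)]
        simp only [if_pos ho, mul_one, Pi.one_apply, dlog_pow h1, sum_const, card_range,
          Nat.cast_mul]
        simp [lowerAt]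

variable {A : Type*} [AddCommGroup A] [Module (MonoidAlgebra ℤ (∀ r, C r)) A]
  (hA : ∀ (x : ∀ r, C r) (a : A), MonoidAlgebra.single x (1 : ℤ) • a = a)
include hA

omit hg in
-- With trivial action the group element of a basis vector is invisible, and only its multidegree
-- counts.
lemma kos_map_eq (F : Kos C →ₗ[MonoidAlgebra ℤ (∀ r, C r)] A) (v : Kos C) :
    F v = Finsupp.linearCombination ℤ (fun y => F (Finsupp.single (deg y) 1)) (tensEquiv v) := by
  have : F.toAddMonoidHom.toIntLinearMap = Finsupp.linearCombination ℤ
      (fun y => F (Finsupp.single (deg y) 1)) ∘ₗ tensEquiv.toLinearMap := by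
    refine Kos.hom_ext fun lam x => ?_
    rw [LinearMap.comp_apply, LinearEquiv.coe_coe, tensEquiv_single,
      Finsupp.linearCombination_single, one_smul, AddMonoidHom.coe_toIntLinearMap,
      LinearMap.toAddMonoidHom_coe, ← mul_one (MonoidAlgebra.single x (1 : ℤ)), ← smul_eq_mul,
      ← Finsupp.smul_single, map_smul, hA]
    rfl
  exact LinearMap.congr_fun this v

omit hg in
lemma kos_map_boundary (F : Kos C →ₗ[MonoidAlgebra ℤ (∀ r, C r)] A) (lam : Fin n → ℕ) :
    F (kosD g (Finsupp.single lam 1)) = ∑ r, if lam r ≠ 0 ∧ Even (lam r) then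
        (-1 : ℤ) ^ (∑ s ∈ Ioi r, lam s) • orderOf (g r) • F (Finsupp.single (lowerAt r lam) 1)
        else 0 := by
  rw [kos_map_eq hA, tensEquiv_kosD, MonoidAlgebra.one_def, tensEquiv_single]
  exact map_tensD g (fun lam => F (Finsupp.single lam 1)) fun r => (lam r, 1)

lemma kos_map_barToKos (F : Kos C →ₗ[MonoidAlgebra ℤ (∀ r, C r)] A) (k : ℕ)
    (hF : F ∘ₗ kosProj C k = F) (α : ℕ → Fin n → ℕ)
    (hα : ∀ j ∈ Icc 1 k, ∀ r, α j r < orderOf (g r)) :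
    F (barToKos g k (barSymbol _ fun (j : Fin k) r => g r ^ α (j + 1) r)) =
      ∑ lam ∈ piAntidiag univ k, multiFactor (fun r => orderOf (g r)) α lam •
        F (Finsupp.single lam 1) := by
  have key : ∀ v : Tens C, Finsupp.linearCombination ℤ (fun y => F (Finsupp.single (deg y) 1)) v =
      ∑ lam ∈ piAntidiag univ k, degCoeff lam v • F (Finsupp.single lam 1) := by
    intro v
    have : Finsupp.linearCombination ℤ (fun y : ∀ r, ℕ × C r => F (Finsupp.single (deg y) 1)) =
        ∑ lam ∈ piAntidiag univ k, (degCoeff lam).smulRight (F (Finsupp.single lam 1)) := by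
      refine Finsupp.lhom_ext' fun y => LinearMap.ext_ring ?_
      simp only [LinearMap.comp_apply, Finsupp.lsingle_apply, Finsupp.linearCombination_single,
        one_smul, LinearMap.sum_apply, LinearMap.smulRight_apply, degCoeff_single, ite_smul,
        zero_smul, sum_ite_eq]
      split_ifs with h
      · rfl
      · rw [← hF, LinearMap.comp_apply, kosProj_single, if_neg, map_zero]
        simpa using h
    rw [this]
    simp
  rw [kos_map_eq hA, key]
  refine sum_congr rfl fun lam hlam => ?_
  rw [degCoeff_barToKos hg k α hα lam (by simpa using hlam), natCast_zsmul]

end Values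

/-! ### Normal forms of cocycles on the tensor product -/

section NormalForm

open Finset Function

variable {n : ℕ} {A : Type*} [AddCommGroup A] (m : Fin n → ℕ)

/-- The coboundary of a function of the multidegree. -/
def cob (u : (Fin n → ℕ) → A) (lam : Fin n → ℕ) : A :=
  ∑ r, if lam r ≠ 0 ∧ Even (lam r) then
    (-1 : ℤ) ^ (∑ s ∈ Ioi r, lam s) • m r • u (lowerAt r lam) else 0

lemma cob_sub (u v : (Fin n → ℕ) → A) : cob m (u - v) = cob m u - cob m v := by
  funext lam
  rw [Pi.sub_apply, cob, cob, cob, ← sum_sub_distrib]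
  refine sum_congr rfl fun r _ => ?_
  split_ifs
  · rw [Pi.sub_apply, smul_sub, smul_sub]
  · rw [sub_zero]

/-- The first nonzero entry of `lam` is at `r`. -/
def FirstAt (lam : Fin n → ℕ) (r : Fin n) : Prop := lam r ≠ 0 ∧ ∀ s < r, lam s = 0

lemma FirstAt.unique {lam : Fin n → ℕ} {r t : Fin n} (h : FirstAt lam r) (h' : FirstAt lam t) :
    r = t := by
  rcases lt_trichotomy r t with hlt | rfl | hlt
  · exact absurd (h'.2 r hlt) h.1
  · rfl
  · exact absurd (h.2 t hlt) h'.1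

lemma exists_firstAt {lam : Fin n → ℕ} {r : Fin n} (h : lam r ≠ 0) :
    ∃ t ≤ r, FirstAt lam t := by
  have hne : (univ.filter fun r => lam r ≠ 0).Nonempty := ⟨r, by simpa using h⟩
  refine ⟨_, min'_le _ r (by simpa using h), (mem_filter.1 (min'_mem _ hne)).2, fun s hs => ?_⟩
  by_contra h'
  exact absurd (min'_le _ s (mem_filter.2 ⟨mem_univ s, h'⟩)) (not_le.2 hs)

lemma FirstAt.lowerAt_of_lt {lam : Fin n → ℕ} {r t : Fin n} (h : FirstAt lam r) (hlt : r < t) :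
    FirstAt (lowerAt t lam) r ∧ lowerAt t lam r = lam r := by
  have e : ∀ s, s ≠ t → lowerAt t lam s = lam s := fun s hs => update_of_ne hs _ _
  refine ⟨⟨?_, fun s hs => ?_⟩, e r hlt.ne⟩
  · rw [e r hlt.ne]; exact h.1
  · rw [e s (hs.trans hlt).ne]; exact h.2 s hs

/-- Vanishing on the multidegrees whose first nonzero entry is even. -/
def EvenZero (u : (Fin n → ℕ) → A) : Prop := ∀ lam r, FirstAt lam r → Even (lam r) → u lam = 0

/-- Normal cocycles. -/
structure Normal (u : (Fin n → ℕ) → A) : Prop where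
  torsion : ∀ lam r, lam r ≠ 0 → m r • u lam = 0
  evenZero : EvenZero u

variable {m}

/-- Only positive even entries contribute; lowered by one they are odd, hence still nonzero, so the
factor `m r` kills the value. -/
lemma Normal.cob_eq_zero {u : (Fin n → ℕ) → A} (hu : Normal m u) : cob m u = 0 := by
  funext lam
  refine sum_eq_zero fun r _ => ?_
  split_ifs with h
  · rw [hu.torsion, smul_zero]
    rw [lowerAt, update_self]
    obtain ⟨j, hj⟩ := h.2
    omega
  · rfl

/-- Lowering a later entry leaves the first one even, so those values of `w` are zero. -/
lemma EvenZero.cob_eq {w : (Fin n → ℕ) → A} (hw : EvenZero w) {lam : Fin n → ℕ} {r : Fin n}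
    (h : FirstAt lam r) (he : Even (lam r)) :
    cob m w lam = (-1 : ℤ) ^ (∑ s ∈ Ioi r, lam s) • m r • w (lowerAt r lam) := by
  rw [cob, sum_eq_single r, if_pos ⟨h.1, he⟩]
  · intro t _ ht
    split_ifs with h'
    · rcases lt_or_gt_of_ne ht with hlt | hlt
      · exact absurd (h.2 t hlt) h'.1
      · obtain ⟨h1, h2⟩ := h.lowerAt_of_lt hlt
        rw [hw _ r h1 (by rwa [h2]), smul_zero, smul_zero]
    · rfl
  · simp

/-- Raising the first entry by one makes it even, and the coboundary at the raised multidegree is `±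
m r • v lam`. -/
lemma EvenZero.torsion {v : (Fin n → ℕ) → A} (hv : EvenZero v) (hd : EvenZero (cob m v))
    {lam : Fin n → ℕ} {r : Fin n} (h : FirstAt lam r) (ho : Odd (lam r)) : m r • v lam = 0 := by
  have h1 : FirstAt (update lam r (lam r + 1)) r :=
    ⟨by simp, fun s hs => by rw [update_of_ne hs.ne, h.2 s hs]⟩
  have h2 : Even (update lam r (lam r + 1) r) := by rw [update_self]; exact ho.add_one
  have h3 := hd _ r h1 h2
  have h4 : lowerAt r (update lam r (lam r + 1)) = lam := by simp [lowerAt]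
  rw [hv.cob_eq h1 h2, h4] at h3
  rcases neg_one_pow_eq_or ℤ (∑ s ∈ Ioi r, update lam r (lam r + 1) s) with h | h
  · simpa [h] using h3
  · simpa [h] using h3

variable (hdvd : ∀ r t : Fin n, r ≤ t → m r ∣ m t)
include hdvd

/-- Torsion at the first nonzero position passes to every later one by the divisibility `m t ∣ m r`
for `t ≤ r`. -/
lemma EvenZero.normal {v : (Fin n → ℕ) → A} (hv : EvenZero v) (hd : EvenZero (cob m v)) :
    Normal m v where
  evenZero := hv
  torsion lam r hr := by
    obtain ⟨t, htr, ht⟩ := exists_firstAt hr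
    rcases Nat.even_or_odd (lam t) with he | ho
    · rw [hv lam t ht he, smul_zero]
    · obtain ⟨c, hc⟩ := hdvd t r htr
      rw [hc, mul_comm, mul_smul, hv.torsion hd ht ho, smul_zero]

omit hdvd in
-- Choose `w` by dividing `± u` by `m r`: its value at `kap`, with odd first entry, is prescribed by
-- the value of `u` with that entry raised by one. Setting `w = 0` at even first entries keeps the
-- other terms of `cob` out.
lemma exists_evenZero (hdiv : ∀ r (a : A), ∃ b, m r • b = a) (u : (Fin n → ℕ) → A) :
    ∃ w, EvenZero (u - cob m w) := by
  have : ∀ kap : Fin n → ℕ, ∃ b : A,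
      (∀ r, FirstAt kap r → Odd (kap r) →
        m r • b = (-1 : ℤ) ^ (∑ s ∈ Ioi r, kap s) • u (update kap r (kap r + 1))) ∧
      (∀ r, FirstAt kap r → Even (kap r) → b = 0) := by
    intro kap
    by_cases h : ∃ r, FirstAt kap r ∧ Odd (kap r)
    · obtain ⟨r, hr, ho⟩ := h
      obtain ⟨b, hb⟩ := hdiv r ((-1 : ℤ) ^ (∑ s ∈ Ioi r, kap s) • u (update kap r (kap r + 1)))
      refine ⟨b, fun t ht _ => ?_, fun t ht he => ?_⟩
      · obtain rfl := hr.unique ht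
        exact hb
      · obtain rfl := hr.unique ht
        exact absurd he (Nat.not_even_iff_odd.2 ho)
    · exact ⟨0, fun t ht ho => absurd ⟨t, ht, ho⟩ h, fun _ _ _ => rfl⟩
  choose w hw hw0 using this
  refine ⟨w, fun lam r hr he => ?_⟩
  have hw0' : EvenZero w := fun lam r => hw0 lam r
  have hr2 : 2 ≤ lam r := by
    have := hr.1
    obtain ⟨j, hj⟩ := he
    omega
  have h1 : FirstAt (lowerAt r lam) r := by
    refine ⟨?_, fun s hs => ?_⟩
    · rw [lowerAt, update_self]; omega
    · rw [lowerAt, update_of_ne hs.ne, hr.2 s hs]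
  have h2 : Odd (lowerAt r lam r) := by
    rw [lowerAt, update_self]
    exact Nat.Even.sub_odd (by omega) he odd_one
  have h3 : update (lowerAt r lam) r (lowerAt r lam r + 1) = lam := by
    simp only [lowerAt, update_self, update_idem]
    rw [Nat.sub_add_cancel (by omega), update_eq_self]
  have h4 : ∑ s ∈ Ioi r, lowerAt r lam s = ∑ s ∈ Ioi r, lam s :=
    sum_congr rfl fun s hs => update_of_ne (ne_of_gt (mem_Ioi.1 hs)) _ _
  rw [Pi.sub_apply, hw0'.cob_eq hr he, hw _ r h1 h2, h3, h4, smul_smul, ← mul_pow]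
  simp

lemma exists_normal (hdiv : ∀ r (a : A), ∃ b, m r • b = a)
    (hcob : ∀ w : (Fin n → ℕ) → A, cob m (cob m w) = 0) {u : (Fin n → ℕ) → A}
    (hu : cob m u = 0) : ∃ w, Normal m (u - cob m w) := by
  obtain ⟨w, hw⟩ := exists_evenZero hdiv u
  refine ⟨w, hw.normal hdvd ?_⟩
  rw [cob_sub, hu, hcob, sub_zero]
  exact fun _ _ _ _ => rfl

/-- A primitive can itself be cleared at even first entries without changing its coboundary. The
coboundary also vanishes there, so the cleared primitive is normal, hence a cocycle. -/
lemma Normal.eq_zero (hdiv : ∀ r (a : A), ∃ b, m r • b = a)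
    (hcob : ∀ w : (Fin n → ℕ) → A, cob m (cob m w) = 0) {w : (Fin n → ℕ) → A}
    (hv : Normal m (cob m w)) : cob m w = 0 := by
  obtain ⟨t, ht⟩ := exists_evenZero hdiv w
  have e : cob m w = cob m (w - cob m t) := by rw [cob_sub, hcob, sub_zero]
  rw [e] at hv ⊢
  generalize w - cob m t = w' at *
  funext lam
  refine sum_eq_zero fun s _ => ?_
  split_ifs with hs
  · have hn := ht.normal hdvd hv.evenZero
    rw [hn.torsion, smul_zero]
    rw [lowerAt, update_self]
    obtain ⟨j, hj⟩ := hs.2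
    omega
  · rfl

end NormalForm

/-! ### Normal representatives of the cohomology classes -/

section Representatives

open Finset Function

variable {n : ℕ} {C : Fin n → Type} [∀ r, CommGroup (C r)] {g : ∀ r, C r}
  {A : Type*} [AddCommGroup A] [Module (MonoidAlgebra ℤ (∀ r, C r)) A]

variable (C) in
/-- The homomorphism with values `u` on the basis of multidegrees. -/
abbrev kosHom (u : (Fin n → ℕ) → A) : Kos C →ₗ[MonoidAlgebra ℤ (∀ r, C r)] A :=
  Finsupp.linearCombination _ u

lemma kosHom_single (u : (Fin n → ℕ) → A) (lam : Fin n → ℕ) :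
    kosHom C u (Finsupp.single lam 1) = u lam := by simp

lemma kosHom_eq (F : Kos C →ₗ[MonoidAlgebra ℤ (∀ r, C r)] A) :
    kosHom C (fun lam => F (Finsupp.single lam 1)) = F := by
  refine Finsupp.lhom_ext' fun lam => LinearMap.ext_ring ?_
  simp

variable (hg : ∀ r, IsGen (g r))
  (hA : ∀ (x : ∀ r, C r) (a : A), MonoidAlgebra.single x (1 : ℤ) • a = a)

include hA in
lemma kosHom_comp_kosD (u : (Fin n → ℕ) → A) :
    kosHom C u ∘ₗ kosD g = kosHom C (cob (fun r => orderOf (g r)) u) := by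
  refine Finsupp.lhom_ext' fun lam => LinearMap.ext_ring ?_
  rw [LinearMap.comp_apply, LinearMap.comp_apply, LinearMap.comp_apply, Finsupp.lsingle_apply,
    kos_map_boundary hA, kosHom_single, cob]
  simp only [kosHom_single]

include hg hA in
lemma cob_cob (u : (Fin n → ℕ) → A) :
    cob (fun r => orderOf (g r)) (cob (fun r => orderOf (g r)) u) = 0 := by
  funext lam
  rw [← kosHom_single (C := C) (cob _ (cob _ u)), ← kosHom_comp_kosD (g := g) hA,
    ← kosHom_comp_kosD (g := g) hA, LinearMap.comp_apply, LinearMap.comp_apply, kosD_kosD hg,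
    map_zero, Pi.zero_apply]

include hg hA in
lemma Normal.comp_boundary {u : (Fin n → ℕ) → A} (hu : Normal (fun r => orderOf (g r)) u) (k : ℕ) :
    (kosHom C u ∘ₗ barToKos g k) ∘ₗ barBoundary _ k = 0 := by
  refine LinearMap.ext fun b => ?_
  rw [LinearMap.comp_apply, LinearMap.comp_apply, ← barToKos_boundary hg, ← LinearMap.comp_apply,
    kosHom_comp_kosD hA, hu.cob_eq_zero, LinearMap.zero_apply]
  simp

variable (hdiv : ∀ r (a : A), ∃ b, orderOf (g r) • b = a)
  (hdvd : ∀ r t : Fin n, r ≤ t → orderOf (g r) ∣ orderOf (g t))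

include hg hA hdiv hdvd in
lemma exists_normal_representative (k : ℕ) (z : Bar (∀ r, C r) (k + 1) →ₗ[MonoidAlgebra ℤ _] A)
    (hz : z ∘ₗ barBoundary _ (k + 1) = 0) : ∃ u : (Fin n → ℕ) → A,
      Normal (fun r => orderOf (g r)) u ∧ (∀ lam, ∑ r, lam r ≠ k + 1 → u lam = 0) ∧
        ∃ y, z - kosHom C u ∘ₗ barToKos g (k + 1) = y ∘ₗ barBoundary _ k := by
  obtain ⟨F, hF, hFP, y, hy⟩ := (exists_comparison (A := A) hg k).1 z hz
  obtain ⟨w, hw⟩ := exists_normal hdvd hdiv (cob_cob hg hA)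
    (u := fun lam => F (Finsupp.single lam 1)) (by
      funext lam
      rw [← kosHom_single (C := C) (cob _ _), ← kosHom_comp_kosD hA, kosHom_eq, hF]
      rfl)
  set v := (fun lam => F (Finsupp.single lam 1)) - cob (fun r => orderOf (g r)) w with hv
  -- Neither `w` nor `v` need be confined to one total degree, so `v` is cut to degree `k + 1` and
  -- correspondingly `w` to degree `k`.
  refine ⟨fun lam => if ∑ r, lam r = k + 1 then v lam else 0, ⟨fun lam r h => ?_, fun lam r h h' => ?_⟩,
    fun lam h => if_neg h, y + kosHom C w ∘ₗ kosProj C k ∘ₗ barToKos g k, ?_⟩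
  · split_ifs
    · exact hw.torsion lam r h
    · rw [smul_zero]
  · split_ifs
    · exact hw.evenZero lam r h h'
    · rfl
  · have e1 : F = kosHom C v + kosHom C w ∘ₗ kosD g := by
      rw [kosHom_comp_kosD hA]
      refine Finsupp.lhom_ext' fun lam => LinearMap.ext_ring ?_
      simp [hv]
    have e2 : kosHom C (fun lam => if ∑ r, lam r = k + 1 then v lam else 0) =
        kosHom C v ∘ₗ kosProj C (k + 1) := by
      refine Finsupp.lhom_ext' fun lam => LinearMap.ext_ring ?_
      simp only [LinearMap.comp_apply, Finsupp.lsingle_apply, kosProj_single, kosHom_single]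
      split_ifs
      · rw [kosHom_single]
      · rw [map_zero]
    refine LinearMap.ext fun b => ?_
    have h1 := LinearMap.congr_fun hy b
    rw [← hFP, e1, ← sub_eq_zero] at h1
    rw [e2, ← sub_eq_zero, ← h1]
    simp only [LinearMap.sub_apply, LinearMap.add_apply, LinearMap.comp_apply, kosD_kosProj,
      barToKos_boundary hg]
    abel

include hg hA hdiv hdvd in
lemma Normal.eq_zero_of_coboundary (k : ℕ) {u : (Fin n → ℕ) → A}
    (hu : Normal (fun r => orderOf (g r)) u) (hk : ∀ lam, ∑ r, lam r ≠ k + 1 → u lam = 0)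
    (h : ∃ y, kosHom C u ∘ₗ barToKos g (k + 1) = y ∘ₗ barBoundary _ k) : u = 0 := by
  obtain ⟨F, hF⟩ := (exists_comparison (A := A) hg k).2 (kosHom C u)
    (by
      rw [kosHom_comp_kosD hA, hu.cob_eq_zero]
      refine Finsupp.lhom_ext' fun lam => LinearMap.ext_ring ?_
      simp) h
  have e : u = cob (fun r => orderOf (g r)) (fun lam => F (Finsupp.single lam 1)) := by
    funext lam
    rw [← kosHom_single (C := C) (cob _ _), ← kosHom_comp_kosD hA, kosHom_eq, ← hF,
      LinearMap.comp_apply, kosProj_single]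
    split_ifs with h'
    · rw [kosHom_single]
    · rw [map_zero, hk lam h']
  rw [e] at hu ⊢
  exact hu.eq_zero hdvd hdiv (cob_cob hg hA)

lemma Normal.sub {m : Fin n → ℕ} {u v : (Fin n → ℕ) → A} (hu : Normal m u) (hv : Normal m v) :
    Normal m (u - v) where
  torsion lam r h := by rw [Pi.sub_apply, smul_sub, hu.torsion lam r h, hv.torsion lam r h, sub_zero]
  evenZero lam r h h' := by
    rw [Pi.sub_apply, hu.evenZero lam r h h', hv.evenZero lam r h h', sub_zero]

end Representatives

/-! ### The indices as multidegrees -/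

section Indices

open Finset Function

variable {n : ℕ}

/-- The multidegree `r_1^{λ_1} ⋯ r_l^{λ_l}`. -/
def toDegree {l : ℕ} (r : Fin l → Fin n) (lam : Fin l → ℕ) (s : Fin n) : ℕ :=
  ∑ i, if r i = s then lam i else 0

section

variable {l : ℕ} {r : Fin l → Fin n} (hr : StrictMono r) (lam : Fin l → ℕ)
include hr

lemma toDegree_apply (i : Fin l) : toDegree r lam (r i) = lam i := by
  rw [toDegree, sum_eq_single i]
  · rw [if_pos rfl]
  · intro j _ hj
    rw [if_neg fun h => hj (hr.injective h)]
  · simp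

omit hr in
lemma toDegree_eq_zero {s : Fin n} (hs : s ∉ Set.range r) : toDegree r lam s = 0 :=
  sum_eq_zero fun i _ => if_neg fun h => hs ⟨i, h⟩

lemma sum_toDegree_Ioi (u : Fin l) : ∑ s ∈ Ioi (r u), toDegree r lam s = ∑ i ∈ Ioi u, lam i := by
  refine (sum_of_injOn r hr.injective.injOn (fun i hi => ?_) (fun s hs hs' => ?_)
    (fun i _ => (toDegree_apply hr lam i).symm)).symm
  · have := mem_Ioi.1 (mem_coe.1 hi)
    exact mem_coe.2 (mem_Ioi.2 (hr this))
  · refine toDegree_eq_zero lam ?_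
    rintro ⟨i, rfl⟩
    exact hs' ⟨i, mem_coe.2 (mem_Ioi.2 (hr.lt_iff_lt.1 (mem_Ioi.1 hs))), rfl⟩

lemma sum_toDegree : ∑ s, toDegree r lam s = ∑ i, lam i := by
  refine (sum_of_injOn r hr.injective.injOn (fun i hi => mem_coe.2 (mem_univ _))
    (fun s hs hs' => ?_) (fun i _ => (toDegree_apply hr lam i).symm)).symm
  refine toDegree_eq_zero lam ?_
  rintro ⟨i, rfl⟩
  exact hs' ⟨i, mem_coe.2 (mem_univ _), rfl⟩

/-- Slots not among the `r_i` have degree zero and contribute `1`. In the others the tail sums of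
the multidegree are the tail sums of `lam`, which gives the bounds `lower` and `upper`. -/
lemma multiFactor_toDegree (m : Fin n → ℕ) (α : ℕ → Fin n → ℕ) (hlam : ∀ i, 1 ≤ lam i) :
    multiFactor m α (toDegree r lam) =
      ∏ u, eta (m (r u)) (fun j => α j (r u)) (lower lam u) (upper lam u) := by
  refine (prod_of_injOn r hr.injective.injOn (fun i hi => mem_coe.2 (mem_univ _))
    (fun s hs hs' => ?_) (fun u _ => ?_)).symm
  · rw [toDegree_eq_zero, cycFactor_zero]
    rintro ⟨i, rfl⟩
    exact hs' ⟨i, mem_coe.2 (mem_univ _), rfl⟩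
  · have e : upper lam u = lower lam u + lam u - 1 := by
      rw [upper, lower, ← Ioi_insert, sum_insert (by simp)]
      omega
    rw [e, eta_eq_cycFactor _ _ _ (hlam u), toDegree_apply hr, sum_toDegree_Ioi hr, lower]

end

lemma toDegree_firstAt {l : ℕ} {r : Fin (l + 1) → Fin n} (hr : StrictMono r)
    {lam : Fin (l + 1) → ℕ} (hlam : ∀ i, 1 ≤ lam i) : FirstAt (toDegree r lam) (r 0) := by
  refine ⟨?_, fun s hs => toDegree_eq_zero lam ?_⟩
  · rw [toDegree_apply hr]
    exact Nat.one_le_iff_ne_zero.1 (hlam 0)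
  · rintro ⟨i, rfl⟩
    exact absurd (hr.lt_iff_lt.1 hs) (Fin.not_lt_zero i)

lemma mem_indices {k l : ℕ} {r : Fin (l + 1) → Fin n} {lam : Fin (l + 1) → ℕ} :
    (⟨l, r, lam⟩ : Σ l : ℕ, (Fin (l + 1) → Fin n) × (Fin (l + 1) → ℕ)) ∈ indices n k ↔
      l < k ∧ StrictMono r ∧ ∑ i, lam i = k ∧ (∀ i, 1 ≤ lam i) ∧ Odd (lam 0) := by
  simp [indices]

/-- Since all `λ_i ≥ 1`, the `r_i` are recovered as the increasing enumeration of the support, and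
the `λ_i` as the values on it. -/
lemma toDegree_injOn {k : ℕ} {p q : Σ l : ℕ, (Fin (l + 1) → Fin n) × (Fin (l + 1) → ℕ)}
    (hp : p ∈ indices n k) (hq : q ∈ indices n k)
    (h : toDegree p.2.1 p.2.2 = toDegree q.2.1 q.2.2) : p = q := by
  obtain ⟨l, r, lam⟩ := p
  obtain ⟨l', r', lam'⟩ := q
  obtain ⟨-, hr, -, hlam, -⟩ := mem_indices.1 hp
  obtain ⟨-, hr', -, hlam', -⟩ := mem_indices.1 hq
  have hrange : ∀ {l : ℕ} {r : Fin (l + 1) → Fin n} {lam : Fin (l + 1) → ℕ}, StrictMono r →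
      (∀ i, 1 ≤ lam i) → Set.range r = {s | toDegree r lam s ≠ 0} := by
    intro l r lam hr hlam
    ext s
    constructor
    · rintro ⟨i, rfl⟩
      show toDegree r lam (r i) ≠ 0
      rw [toDegree_apply hr]
      exact Nat.one_le_iff_ne_zero.1 (hlam i)
    · intro hs
      by_contra h'
      exact hs (toDegree_eq_zero lam h')
  simp only at h
  have hR : Set.range r = Set.range r' := by rw [hrange hr hlam, hrange hr' hlam', h]
  have hl : l = l' := by
    have h1 := Set.ncard_range_of_injective hr.injective
    have h2 := Set.ncard_range_of_injective hr'.injective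
    rw [hR, h2] at h1
    simpa using h1.symm
  subst hl
  obtain rfl := (hr.range_inj hr').1 hR
  congr 2
  funext i
  rw [← toDegree_apply hr lam, h, toDegree_apply hr]

lemma exists_toDegree {kap : Fin n → ℕ} {s : Fin n} (hs : FirstAt kap s) (ho : Odd (kap s)) :
    ∃ p ∈ indices n (∑ t, kap t), toDegree p.2.1 p.2.2 = kap := by
  set S := univ.filter fun t => kap t ≠ 0 with hS
  have hsS : s ∈ S := by simpa [hS] using hs.1
  obtain ⟨l, hl⟩ : ∃ l, #S = l + 1 :=
    ⟨#S - 1, by have := card_pos.2 ⟨s, hsS⟩; omega⟩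
  have hr := (S.orderEmbOfFin hl).strictMono
  have hmem : ∀ i, kap (S.orderEmbOfFin hl i) ≠ 0 := fun i =>
    (mem_filter.1 (S.orderEmbOfFin_mem hl i)).2
  have hrange : ∀ t, kap t ≠ 0 → t ∈ Set.range (S.orderEmbOfFin hl) := fun t ht => by
    rw [range_orderEmbOfFin]
    simpa [hS] using ht
  have hdeg : toDegree (S.orderEmbOfFin hl) (fun i => kap (S.orderEmbOfFin hl i)) = kap := by
    funext t
    by_cases ht : kap t = 0
    · rw [ht, toDegree_eq_zero]
      rintro ⟨i, rfl⟩
      exact hmem i ht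
    · obtain ⟨i, rfl⟩ := hrange t ht
      rw [toDegree_apply hr]
  have hsum : ∑ i, kap (S.orderEmbOfFin hl i) = ∑ t, kap t := by
    conv_rhs => rw [← hdeg]
    rw [sum_toDegree hr]
  have hone : ∀ i, 1 ≤ kap (S.orderEmbOfFin hl i) := fun i => Nat.one_le_iff_ne_zero.2 (hmem i)
  refine ⟨⟨l, S.orderEmbOfFin hl, fun i => kap (S.orderEmbOfFin hl i)⟩,
    mem_indices.2 ⟨?_, hr, hsum, hone, ?_⟩, hdeg⟩
  · rw [← hsum]
    have := sum_le_sum fun i (_ : i ∈ (univ : Finset (Fin (l + 1)))) => hone i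
    simpa using this
  · have h0 := toDegree_firstAt hr hone
    rw [hdeg] at h0
    rw [h0.unique hs]
    exact ho

end Indices

/-! ### The explicit cochains -/

section Explicit

open Finset Function

variable {𝕜 : Type*} [Field 𝕜] {n : ℕ}

section Trivial

variable {G : Type} [Group G]

/-- A unit as an element of the trivial module. -/
def unitElt (G : Type) [Group G] (x : 𝕜ˣ) : UnitsModule G 𝕜 :=
  (Representation.trivial ℤ G (Additive 𝕜ˣ)).asModuleEquiv.symm (Additive.ofMul x)

/-- The unit underlying an element of the trivial module. -/
def toUnit (a : UnitsModule G 𝕜) : 𝕜ˣ :=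
  Additive.toMul ((Representation.trivial ℤ G (Additive 𝕜ˣ)).asModuleEquiv a)

lemma toUnit_unitElt (x : 𝕜ˣ) : toUnit (unitElt G x) = x := rfl

lemma toUnit_injective : Injective (toUnit : UnitsModule G 𝕜 → 𝕜ˣ) := fun _ _ h => h

lemma toUnit_zero : toUnit (0 : UnitsModule G 𝕜) = 1 := rfl

lemma toUnit_zsmul (z : ℤ) (a : UnitsModule G 𝕜) : toUnit (z • a) = toUnit a ^ z := by
  rw [toUnit, map_zsmul]
  rfl

lemma toUnit_nsmul (z : ℕ) (a : UnitsModule G 𝕜) : toUnit (z • a) = toUnit a ^ z := by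
  rw [toUnit, map_nsmul]
  rfl

lemma toUnit_sum {ι : Type*} (s : Finset ι) (f : ι → UnitsModule G 𝕜) :
    toUnit (∑ i ∈ s, f i) = ∏ i ∈ s, toUnit (f i) := by
  rw [toUnit, map_sum]
  rfl

lemma single_smul_units (x : G) (a : UnitsModule G 𝕜) :
    MonoidAlgebra.single x (1 : ℤ) • a = a := by
  rw [Representation.single_smul, one_smul]
  rfl

/-- Divisibility of `𝕜ˣ`: roots exist in an algebraically closed field. -/
lemma exists_nsmul_units [IsAlgClosed 𝕜] {m : ℕ} (hm : 0 < m) (a : UnitsModule G 𝕜) :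
    ∃ b : UnitsModule G 𝕜, m • b = a := by
  obtain ⟨z, hz⟩ := IsAlgClosed.exists_pow_nat_eq ((toUnit a : 𝕜ˣ) : 𝕜) hm
  have hz0 : z ≠ 0 := by
    rintro rfl
    rw [zero_pow hm.ne'] at hz
    exact (toUnit a).ne_zero hz.symm
  refine ⟨unitElt G (Units.mk0 z hz0), toUnit_injective ?_⟩
  rw [toUnit_nsmul, toUnit_unitElt]
  ext
  simpa using hz

end Trivial

/-- The sign `(-1)^{∑_{i<j} λ_i λ_j}`. -/
def indexSign {l : ℕ} (lam : Fin l → ℕ) : ℤ :=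
  (-1) ^ (∑ j : Fin l, ∑ i ∈ Finset.Iio j, lam i * lam j)

lemma indexSign_eq_or {l : ℕ} (lam : Fin l → ℕ) : indexSign lam = 1 ∨ indexSign lam = -1 :=
  neg_one_pow_eq_or ℤ _

variable (m : Fin n → ℕ) (ζ : ℕ → 𝕜ˣ) (k : ℕ)

/-- The normal cocycle with given parameters. -/
def paramCocycle (a : Params m k) (kap : Fin n → ℕ) : UnitsModule (AbGroup m) 𝕜 :=
  ∑ p : indices n k, if toDegree p.1.2.1 p.1.2.2 = kap then
    (indexSign p.1.2.2 * (a p : ℕ)) • unitElt (AbGroup m) (ζ (m (p.1.2.1 0))) else 0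

lemma paramCocycle_toDegree (a : Params m k) (p : indices n k) :
    paramCocycle m ζ k a (toDegree p.1.2.1 p.1.2.2) =
      (indexSign p.1.2.2 * (a p : ℕ)) • unitElt (AbGroup m) (ζ (m (p.1.2.1 0))) := by
  rw [paramCocycle, sum_eq_single p]
  · rw [if_pos rfl]
  · intro q _ hq
    rw [if_neg fun h => hq (Subtype.ext (toDegree_injOn q.2 p.2 h))]
  · simp

lemma index_facts (p : indices n k) : StrictMono p.1.2.1 ∧ ∑ i, p.1.2.2 i = k ∧
    (∀ i, 1 ≤ p.1.2.2 i) ∧ Odd (p.1.2.2 0) :=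
  (mem_indices.1 p.2).2

lemma index_facts_degree (p : indices n k) :
    FirstAt (toDegree p.1.2.1 p.1.2.2) (p.1.2.1 0) ∧ Odd (toDegree p.1.2.1 p.1.2.2 (p.1.2.1 0)) ∧
      ∑ s, toDegree p.1.2.1 p.1.2.2 s = k := by
  obtain ⟨h1, h2, h3, h4⟩ := index_facts k p
  exact ⟨toDegree_firstAt h1 h3, by rwa [toDegree_apply h1], by rw [sum_toDegree h1, h2]⟩

variable {m}

lemma paramCocycle_support (a : Params m k) {kap : Fin n → ℕ} (h : ∑ s, kap s ≠ k) :
    paramCocycle m ζ k a kap = 0 := by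
  refine sum_eq_zero fun p _ => if_neg ?_
  rintro rfl
  exact h (index_facts_degree k p).2.2

variable {ζ} (hζ : ∀ r, IsPrimitiveRoot (ζ (m r)) (m r))
include hζ

/-- A value at `kap` is a power of the root of order `m` at the first nonzero position, and this
order divides `m r` for every `r` with `kap r ≠ 0`. -/
lemma paramCocycle_normal (hdvd : ∀ r t : Fin n, r ≤ t → m r ∣ m t) (a : Params m k) :
    Normal m (paramCocycle m ζ k a) where
  torsion kap r hr := by
    rw [paramCocycle, smul_sum]
    refine sum_eq_zero fun p _ => ?_
    split_ifs with h
    · have hle : p.1.2.1 0 ≤ r := by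
        by_contra hlt
        have := (index_facts_degree k p).1.2 r (not_le.1 hlt)
        rw [h] at this
        exact hr this
      have hz : m r • unitElt (AbGroup m) (ζ (m (p.1.2.1 0))) = 0 := by
        apply toUnit_injective
        rw [toUnit_nsmul, toUnit_unitElt, toUnit_zero]
        exact (hζ _).pow_eq_one_iff_dvd _ |>.2 (hdvd _ _ hle)
      rw [smul_comm, hz, smul_zero]
    · rw [smul_zero]
  evenZero kap r hr he := by
    refine sum_eq_zero fun p _ => if_neg ?_
    rintro rfl
    obtain ⟨h1, h2, -⟩ := index_facts_degree k p
    obtain rfl := h1.unique hr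
    exact absurd he (Nat.not_even_iff_odd.2 h2)

lemma paramCocycle_injective : Injective (paramCocycle m ζ k) := by
  intro a b hab
  funext p
  have h := congr_fun hab (toDegree p.1.2.1 p.1.2.2)
  rw [paramCocycle_toDegree, paramCocycle_toDegree, mul_smul, mul_smul] at h
  have h' : ((a p : ℕ) : ℤ) • unitElt (AbGroup m) (ζ (m (p.1.2.1 0))) =
      ((b p : ℕ) : ℤ) • unitElt (AbGroup m) (ζ (m (p.1.2.1 0))) := by
    rcases indexSign_eq_or p.1.2.2 with hs | hs
    · simpa [hs] using h
    · simpa [hs] using h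
  have h'' := congrArg toUnit h'
  rw [toUnit_zsmul, toUnit_zsmul, toUnit_unitElt, zpow_natCast, zpow_natCast] at h''
  exact Fin.ext ((hζ _).pow_inj (a p).2 (b p).2 h'')

lemma exists_paramCocycle (hm : ∀ r, 0 < m r) {u : (Fin n → ℕ) → UnitsModule (AbGroup m) 𝕜}
    (hu : Normal m u) (hk : ∀ kap, ∑ s, kap s ≠ k → u kap = 0) (h0 : k ≠ 0) :
    ∃ a, paramCocycle m ζ k a = u := by
  -- The value of `u` is torsion of order dividing `m` at the first position, hence so is its
  -- product with the sign, which is then a power of the primitive root. The sign reappears on the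
  -- left because its square is `1`.
  have : ∀ p : indices n k, ∃ c : Fin (m (p.1.2.1 0)),
      (indexSign p.1.2.2 * (c : ℕ)) • unitElt (AbGroup m) (ζ (m (p.1.2.1 0))) =
        u (toDegree p.1.2.1 p.1.2.2) := by
    intro p
    have : NeZero (m (p.1.2.1 0)) := ⟨(hm _).ne'⟩
    have ht := hu.torsion _ _ (index_facts_degree k p).1.1
    have ht' : toUnit (indexSign p.1.2.2 • u (toDegree p.1.2.1 p.1.2.2)) ^ m (p.1.2.1 0) = 1 := by
      rw [← toUnit_nsmul, smul_comm, ht, smul_zero, toUnit_zero]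
    have hprim : IsPrimitiveRoot ((ζ (m (p.1.2.1 0)) : 𝕜ˣ) : 𝕜) (m (p.1.2.1 0)) :=
      IsPrimitiveRoot.coe_units_iff.2 (hζ _)
    obtain ⟨i, hi, h⟩ := hprim.eq_pow_of_pow_eq_one (by
      rw [← Units.val_pow_eq_pow_val, ht', Units.val_one])
    refine ⟨⟨i, hi⟩, ?_⟩
    have h' : (i : ℤ) • unitElt (AbGroup m) (ζ (m (p.1.2.1 0))) =
        indexSign p.1.2.2 • u (toDegree p.1.2.1 p.1.2.2) := by
      apply toUnit_injective
      rw [toUnit_zsmul, toUnit_unitElt, zpow_natCast]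
      ext
      simpa using h
    rw [mul_smul, h', smul_smul]
    rcases indexSign_eq_or p.1.2.2 with hs | hs <;> simp [hs]
  choose a ha using this
  refine ⟨a, funext fun kap => ?_⟩
  by_cases hkap : ∑ s, kap s = k
  · obtain ⟨r, hr⟩ : ∃ r, kap r ≠ 0 := by
      by_contra h
      push Not at h
      exact h0 (by rw [← hkap]; exact sum_eq_zero fun s _ => h s)
    obtain ⟨t, -, ht⟩ := exists_firstAt hr
    rcases Nat.even_or_odd (kap t) with he | ho
    · rw [hu.evenZero kap t ht he]
      refine sum_eq_zero fun p _ => if_neg ?_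
      rintro rfl
      obtain ⟨h1, h2, -⟩ := index_facts_degree k p
      obtain rfl := h1.unique ht
      exact absurd he (Nat.not_even_iff_odd.2 h2)
    · obtain ⟨p, hp, rfl⟩ := exists_toDegree ht ho
      rw [hkap] at hp
      exact (paramCocycle_toDegree m ζ k a ⟨p, hp⟩).trans (ha ⟨p, hp⟩)
  · rw [hk kap hkap, paramCocycle_support ζ k a hkap]

omit hζ in
/-- The value of the combination of the coefficients `multiFactor`. -/
lemma toUnit_sum_multiFactor (a : Params m k) (α : ℕ → Fin n → ℕ) :
    toUnit (∑ kap ∈ piAntidiag univ k, multiFactor m α kap • paramCocycle m ζ k a kap) =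
      explicitValue m ζ k a α := by
  have e : ∑ kap ∈ piAntidiag univ k, multiFactor m α kap • paramCocycle m ζ k a kap =
      ∑ p : indices n k, multiFactor m α (toDegree p.1.2.1 p.1.2.2) •
        (indexSign p.1.2.2 * (a p : ℕ)) • unitElt (AbGroup m) (ζ (m (p.1.2.1 0))) := by
    simp only [paramCocycle, smul_sum]
    rw [sum_comm]
    refine sum_congr rfl fun p _ => ?_
    simp only [smul_ite, smul_zero, sum_ite_eq]
    rw [if_pos]
    simpa using (index_facts_degree k p).2.2
  rw [e, toUnit_sum, explicitValue]
  refine prod_congr rfl fun p _ => ?_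
  obtain ⟨h1, -, h3, -⟩ := index_facts k p
  rw [toUnit_nsmul, toUnit_zsmul, toUnit_unitElt, ← zpow_natCast, ← zpow_mul, exponent,
    multiFactor_toDegree h1 _ m α h3, indexSign, Nat.cast_prod]
  congr 1
  ring

end Explicit

end BarCocycle

end

/-! ### The classification of the cocycles -/

theorem mainTheorem1 {𝕜 : Type*} [Field 𝕜] [IsAlgClosed 𝕜] [CharZero 𝕜]
    (n : ℕ) (m : Fin n → ℕ) (hm : ∀ r, 0 < m r)
    (hdvd : ∀ (i : ℕ) (hi : i + 1 < n), m ⟨i, Nat.lt_of_succ_lt hi⟩ ∣ m ⟨i + 1, hi⟩)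
    (g : (r : Fin n) → Multiplicative (ZMod (m r)))
    (hg : ∀ r, ∀ x : Multiplicative (ZMod (m r)), x ∈ Subgroup.zpowers (g r))
    (ζ : ℕ → 𝕜ˣ) (hζ : ∀ r, IsPrimitiveRoot (ζ (m r)) (m r))
    (k : ℕ) (hk : 1 ≤ k) :
    ∃ ω : BarCocycle.Params m k → BarCocycle.Cochain (BarCocycle.AbGroup m) 𝕜 k,
      -- the cochains are given by the explicit formula, on all of `G^k`
      (∀ (a : BarCocycle.Params m k) (α : ℕ → Fin n → ℕ),
        (∀ j ∈ Finset.Icc 1 k, ∀ r, α j r < m r) →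
        (ω a).value (fun (j : Fin k) (r : Fin n) => g r ^ α ((j : ℕ) + 1) r) =
          BarCocycle.explicitValue m ζ k a α) ∧
      -- they are cocycles
      (∀ a, ω a ∈ BarCocycle.cocycles (BarCocycle.AbGroup m) 𝕜 k) ∧
      -- every cocycle is cohomologous to exactly one of them
      (∀ z ∈ BarCocycle.cocycles (BarCocycle.AbGroup m) 𝕜 k,
        ∃! a, z - ω a ∈ BarCocycle.coboundaries (BarCocycle.AbGroup m) 𝕜 k) := by
  open BarCocycle in
  have hord : ∀ r, orderOf (g r) = m r := fun r => by
    rw [orderOf_eq_card_of_forall_mem_zpowers (hg r)]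
    exact Nat.card_zmod (m r)
  have hord' : (fun r => orderOf (g r)) = m := funext hord
  have hgen : ∀ r, IsGen (g r) := fun r => ⟨by rw [hord]; exact hm r, hg r⟩
  have hdvd' : ∀ r t : Fin n, r ≤ t → m r ∣ m t := by
    have key : ∀ (j i : ℕ) (h : i + j < n), m ⟨i, by omega⟩ ∣ m ⟨i + j, h⟩ := by
      intro j
      induction j with
      | zero => exact fun i h => dvd_rfl
      | succ j ih => exact fun i h => (ih i (by omega)).trans (hdvd (i + j) h)
    intro r t h
    obtain ⟨j, hj⟩ := Nat.exists_eq_add_of_le (Fin.le_def.1 h)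
    have := key j r (by omega)
    convert this
  have hdiv : ∀ r (a : UnitsModule (AbGroup m) 𝕜), ∃ b, orderOf (g r) • b = a := fun r a => by
    rw [hord]; exact exists_nsmul_units (hm r) a
  have hA := single_smul_units (G := AbGroup m) (𝕜 := 𝕜)
  have hdvdo : ∀ r t : Fin n, r ≤ t → orderOf (g r) ∣ orderOf (g t) := fun r t h => by
    rw [hord, hord]; exact hdvd' r t h
  -- Positivity of the degree is essential: the comparison of cohomology and the description of
  -- coboundaries as a range are for degrees `k + 1`.
  obtain ⟨k, rfl⟩ : ∃ i, k = i + 1 := ⟨k - 1, by omega⟩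
  have hN : ∀ a, Normal (fun r => orderOf (g r)) (paramCocycle m ζ (k + 1) a) := fun a => by
    rw [hord']; exact paramCocycle_normal (k + 1) hζ hdvd' a
  refine ⟨fun a => kosHom _ (paramCocycle m ζ (k + 1) a) ∘ₗ barToKos g (k + 1), ?_, ?_, ?_⟩
  · intro a α hα
    have h := kos_map_barToKos hgen hA (kosHom _ (paramCocycle m ζ (k + 1) a)) (k + 1)
      (by
        refine Finsupp.lhom_ext' fun lam => LinearMap.ext_ring ?_
        simp only [LinearMap.comp_apply, Finsupp.lsingle_apply, kosProj_single]
        split_ifs with h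
        · rfl
        · rw [map_zero, kosHom_single, paramCocycle_support ζ (k + 1) a h])
      α (fun j hj r => by rw [hord]; exact hα j hj r)
    simp only [kosHom_single] at h
    rw [hord'] at h
    exact (congrArg toUnit h).trans (toUnit_sum_multiFactor (k + 1) a α)
  · intro a
    exact (hN a).comp_boundary hgen hA (k + 1)
  · intro z hz
    obtain ⟨u, hu, huk, y, hy⟩ := exists_normal_representative hgen hA hdiv hdvdo k z hz
    rw [hord'] at hu
    obtain ⟨a, rfl⟩ := exists_paramCocycle (k + 1) hζ hm hu huk (Nat.succ_ne_zero k)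
    refine ⟨a, ⟨y, hy.symm⟩, ?_⟩
    rintro b ⟨y', hy'⟩
    have hy' : y' ∘ₗ barBoundary _ k =
        z - kosHom _ (paramCocycle m ζ (k + 1) b) ∘ₗ barToKos g (k + 1) := hy'
    -- Two parameters for the same class give a difference that is normal and becomes a coboundary
    -- on the bar resolution, hence is zero.
    have h0 := ((hN b).sub (hN a)).eq_zero_of_coboundary hgen hA hdiv hdvdo k
      (fun lam h => by
        rw [Pi.sub_apply, paramCocycle_support ζ _ a h, paramCocycle_support ζ _ b h, sub_zero])
      ⟨y - y', by
        have e : kosHom _ (paramCocycle m ζ (k + 1) b - paramCocycle m ζ (k + 1) a) =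
            kosHom (fun r => Multiplicative (ZMod (m r))) (paramCocycle m ζ (k + 1) b) -
              kosHom _ (paramCocycle m ζ (k + 1) a) := by
          refine Finsupp.lhom_ext' fun lam => LinearMap.ext_ring ?_
          simp
        rw [e, LinearMap.sub_comp, LinearMap.sub_comp, ← hy, hy']
        abel⟩
    exact paramCocycle_injective (k + 1) hζ (sub_eq_zero.1 h0)
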